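/- **Setting.** Let $V\neq 0$ be a finite-dimensional complex Hilbert space; operators on $V$ carry the operator norm $\|\cdot\|$, and $\overline{\mathrm{Tr}}\,O=\mathrm{Tr}\,O/\mathrm{Tr}\,I$. There are $n$ sites, and to each site $i$ belongs a set $\mathcal G_i$ of operators on $V$ (for qubits, the Pauli operators of the $i$-th qubit; for fermions, the $i$-th Majorana operator). The support $\mathrm{supp}(X)$ of an operator $X$ is the set of sites $i$ such that $X$ is not in the unital algebra generated by $\bigcup_{j\ne i}\mathcal G_j$. Let $\Gamma$ and $A$ be finite index sets, $k\ge 0$ an integer and $a_{\mathrm{loc}},a_{\mathrm{ac}}$ real numbers. Let $H_\gamma$ ($\gamma\in\Gamma$) and $A^a$ ($a\in A$) be operators on $V$ satisfying the following. 1. (Symmetric random Hamiltonian.) Each $H_\gamma$ is Hermitian with $H_\gamma^2=h_\gamma^2 I$, $h_\gamma\ge 0$. The signs $s_\gamma\in\{1,-1\}$ are independent and uniform, and $H=\sum_{\gamma}s_\gamma H_\gamma$. 2. (Commuting or anticommuting.) Each $A^a$ is Hermitian with $(A^a)^2=I$. There are numbers $b_{a\gamma},b_{\gamma\gamma'}\in\{0,1\}$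 with $[A^a,H_\gamma]=2b_{a\gamma}A^aH_\gamma$ and $[H_\gamma,H_{\gamma'}]=2b_{\gamma\gamma'}H_\gamma H_{\gamma'}$; moreover $b_{a\gamma}=0$ if $A^a$ and $H_\gamma$ have disjoint supports, and $b_{\gamma\gamma'}=0$ if $H_\gamma$ and $H_{\gamma'}$ have disjoint supports. 3. (Locality.) $|\mathrm{supp}(A^a)|=1$ for all $a$; $|\mathrm{supp}(H_\gamma)|=k$ and $\sum_{a}b_{a\gamma}=a_{\mathrm{ac}}k$ for all $\gamma$; for every set $Z$ of sites exactly $a_{\mathrm{loc}}|Z|$ of the $A^a$ have a support that meets $Z$; and $a_{\mathrm{ac}}\le a_{\mathrm{loc}}$. For $y\in\mathbb R$ let $K^a=A^a+y[A^a,H]$ and let $$\mathcal L^\dagger(O)=\sum_{a\in A}\Big(K^{a\dagger}OK^a-\tfrac12\big(K^{a\dagger}K^aO+OK^{a\dagger}K^a\big)\Big)$$ (a random superoperator, through the signs). Let $\|H\|_{\mathrm{loc}}=\max_i\big(\sum_{\gamma:\,i\in \mathrm{supp}(H_\gamma)}h_\gamma^2\big)^{1/2}$ (which is $0$ if $n=0$).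 **Proposition.** There is a universal constant $C$ (independent of all the data above and of $y,t,U$ below) such that the following holds. Let $y,t\in\mathbb R$ satisfy $t\ge 0$, $a_{\mathrm{loc}}kt<1$ and $y^2\|H\|_{\mathrm{loc}}^2a_{\mathrm{loc}}k<1/8$, and let $U\subset\Gamma$ with $|U|\le 5$. Then the linear functional $$O\ \longmapsto\ \mathbb E\Big[\Big(\prod_{\alpha\in U}s_\alpha\Big)\,\overline{\mathrm{Tr}}\int_0^t\!\!\int_0^{t_2}e^{t_1\mathcal L^\dagger}(O)\,dt_1\,dt_2\Big]$$ on the operators on $V$, with the norm $\sup_{O\ne0}|\cdot|/\|O\|$, has norm at most $C\,t^2\,|y|^{|U|}\prod_{\alpha\in U}h_\alpha$. -/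

import Mathlib

noncomputable section

namespace RandomLindblad

/-- A system of `n` sites on the Hilbert space `V` is described by the operators `site i` that live
on the site `i`: the single-qubit Pauli operators of the `i`-th qubit for a spin system, the single
Majorana operator `χ i` for a fermionic one.  The support of an operator `X` is the set of sites on
which `X` acts nontrivially, i.e. the sites `i` such that `X` is not in the unital algebra generated
by the operators of the other sites. -/
def opSupport {V : Type*} [NormedAddCommGroup V] [InnerProductSpace ℂ V] {n : ℕ}
    (site : Fin n → Set (V →L[ℂ] V)) (X : V →L[ℂ] V) : Finset (Fin n) :=
  open Classical in
  {i : Fin n | X ∉ Algebra.adjoin ℂ (⋃ j : {j : Fin n // j ≠ i}, site j)}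

/-- The terms `H γ` are Hermitian and square to `h γ ^ 2` times the identity. -/
structure SymmetricTerms {V : Type*} [NormedAddCommGroup V] [InnerProductSpace ℂ V]
    [CompleteSpace V] {Γ : Type*} (H : Γ → V →L[ℂ] V) (h : Γ → ℝ) : Prop where
  selfAdjoint : ∀ γ, IsSelfAdjoint (H γ)
  strength_nonneg : ∀ γ, 0 ≤ h γ
  sq_eq : ∀ γ, H γ * H γ = ((h γ ^ 2 : ℝ) : ℂ) • (1 : V →L[ℂ] V)

/-- The jump operators `A a` are Hermitian involutions; each jump and each Hamiltonian term, and
each pair of Hamiltonian terms, commute (`b = 0`) or anticommute (`b = 1`), and `b = 0` when the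
supports are disjoint. -/
structure CommuteOrAnticommute {V : Type*} [NormedAddCommGroup V] [InnerProductSpace ℂ V]
    [CompleteSpace V] {n : ℕ} {Γ J : Type*} (site : Fin n → Set (V →L[ℂ] V))
    (H : Γ → V →L[ℂ] V) (A : J → V →L[ℂ] V) (b : J → Γ → ℕ) (b' : Γ → Γ → ℕ) : Prop where
  jump_selfAdjoint : ∀ a, IsSelfAdjoint (A a)
  jump_sq : ∀ a, A a * A a = 1
  jump_zero_or_one : ∀ a γ, b a γ = 0 ∨ b a γ = 1
  jump_comm : ∀ a γ, A a * H γ - H γ * A a = ((b a γ : ℂ) * 2) • (A a * H γ)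
  term_zero_or_one : ∀ γ γ', b' γ γ' = 0 ∨ b' γ γ' = 1
  term_comm : ∀ γ γ', H γ * H γ' - H γ' * H γ = ((b' γ γ' : ℂ) * 2) • (H γ * H γ')
  term_disjoint : ∀ γ γ', Disjoint (opSupport site (H γ)) (opSupport site (H γ')) → b' γ γ' = 0
  jump_disjoint : ∀ a γ, Disjoint (opSupport site (A a)) (opSupport site (H γ)) → b a γ = 0

/-- Every jump is supported on one site, every Hamiltonian term on `k` sites; each term
anticommutes with `aac * k` jumps, and for each set `Z` of sites there are `aloc * |Z|` jumps whose
support meets `Z`. -/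
structure LocalJumps {V : Type*} [NormedAddCommGroup V] [InnerProductSpace ℂ V]
    {n : ℕ} {Γ J : Type*} [Fintype J] (site : Fin n → Set (V →L[ℂ] V))
    (H : Γ → V →L[ℂ] V) (A : J → V →L[ℂ] V) (b : J → Γ → ℕ)
    (k : ℕ) (aloc aac : ℝ) : Prop where
  jump_card : ∀ a, (opSupport site (A a)).card = 1
  term_card : ∀ γ, (opSupport site (H γ)).card = k
  aac_le_aloc : aac ≤ aloc
  sum_anticommuting : ∀ γ, ∑ a, (b a γ : ℝ) = aac * k
  card_jumps : ∀ Z : Finset (Fin n),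
    (Nat.card {a : J // (opSupport site (A a) ∩ Z).Nonempty} : ℝ) = aloc * Z.card

/-- The local energy: the maximum over the sites `i` of the square root of the sum of `h γ ^ 2` over
the terms whose support contains `i` (it is `0` if there are no sites). -/
def localEnergy {V : Type*} [NormedAddCommGroup V] [InnerProductSpace ℂ V] {n : ℕ}
    {Γ : Type*} [Fintype Γ] (site : Fin n → Set (V →L[ℂ] V)) (H : Γ → V →L[ℂ] V)
    (h : Γ → ℝ) : ℝ :=
  ⨆ i : Fin n, √(∑ γ with i ∈ opSupport site (H γ), h γ ^ 2)

/-- The Hamiltonian `∑ γ, s γ • H γ` for the choice `s` of signs. -/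
def hamiltonian {V : Type*} [NormedAddCommGroup V] [InnerProductSpace ℂ V]
    {Γ : Type*} [Fintype Γ] (H : Γ → V →L[ℂ] V) (s : Γ → ℤˣ) : V →L[ℂ] V :=
  ∑ γ, ((s γ : ℤ) : ℂ) • H γ

/-- The Lindblad operator `A + y [A, H]`. -/
def lindbladOp {V : Type*} [NormedAddCommGroup V] [InnerProductSpace ℂ V]
    (y : ℝ) (A H : V →L[ℂ] V) : V →L[ℂ] V :=
  A + (y : ℂ) • (A * H - H * A)

/-- The Heisenberg-picture superoperator `O ↦ K† O K - (1/2) {K† K, O}`. -/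
def dissipator {V : Type*} [NormedAddCommGroup V] [InnerProductSpace ℂ V] [CompleteSpace V]
    (K : V →L[ℂ] V) : (V →L[ℂ] V) →L[ℂ] (V →L[ℂ] V) :=
  ContinuousLinearMap.mulLeftRight ℂ (V →L[ℂ] V) (star K) K
    - (1 / 2 : ℂ) • (ContinuousLinearMap.mul ℂ (V →L[ℂ] V) (star K * K)
      + (ContinuousLinearMap.mul ℂ (V →L[ℂ] V)).flip (star K * K))

theorem dissipator_apply {V : Type*} [NormedAddCommGroup V] [InnerProductSpace ℂ V]
    [CompleteSpace V] (K O : V →L[ℂ] V) :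
    dissipator K O = star K * O * K - (1 / 2 : ℂ) • (star K * K * O + O * (star K * K)) := by
  simp [dissipator]

/-- The Heisenberg-picture Lindbladian for the choice `s` of signs. -/
def lindbladian {V : Type*} [NormedAddCommGroup V] [InnerProductSpace ℂ V] [CompleteSpace V]
    {Γ J : Type*} [Fintype Γ] [Fintype J] (H : Γ → V →L[ℂ] V) (A : J → V →L[ℂ] V) (y : ℝ)
    (s : Γ → ℤˣ) : (V →L[ℂ] V) →L[ℂ] (V →L[ℂ] V) :=
  ∑ a, dissipator (lindbladOp y (A a) (hamiltonian H s))

/-- The normalized trace `O ↦ Tr O / Tr I`. -/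
def normalizedTrace (V : Type*) [NormedAddCommGroup V] [InnerProductSpace ℂ V]
    [FiniteDimensional ℂ V] : (V →L[ℂ] V) →L[ℂ] ℂ :=
  LinearMap.toContinuousLinearMap
    ((Module.finrank ℂ V : ℂ)⁻¹ • (LinearMap.trace ℂ V ∘ₗ ContinuousLinearMap.coeLM ℂ))

theorem normalizedTrace_apply {V : Type*} [NormedAddCommGroup V] [InnerProductSpace ℂ V]
    [FiniteDimensional ℂ V] (O : V →L[ℂ] V) :
    normalizedTrace V O = LinearMap.trace ℂ V (O : V →ₗ[ℂ] V) / LinearMap.trace ℂ V 1 := by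
  simp [normalizedTrace, div_eq_inv_mul]

/-- The expectation over independent uniform signs `s : Γ → {1, -1}`. -/
def signExpectation {Γ : Type*} [Fintype Γ] [DecidableEq Γ] {E : Type*} [AddCommGroup E]
    [Module ℂ E] (f : (Γ → ℤˣ) → E) : E :=
  (Fintype.card (Γ → ℤˣ) : ℂ)⁻¹ • ∑ s : Γ → ℤˣ, f s

/-- The linear functional
`O ↦ 𝔼 [(∏ α ∈ U, s α) * Tr (∫ t₂ in 0..t, ∫ t₁ in 0..t₂, exp (t₁ • L†) O) / Tr I]`
on the operators on `V`. -/
def signedIntegral {V : Type*} [NormedAddCommGroup V] [InnerProductSpace ℂ V] [CompleteSpace V]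
    [FiniteDimensional ℂ V] {Γ J : Type*} [Fintype Γ] [DecidableEq Γ] [Fintype J]
    (H : Γ → V →L[ℂ] V) (A : J → V →L[ℂ] V) (y t : ℝ) (U : Finset Γ) : (V →L[ℂ] V) →L[ℂ] ℂ :=
  signExpectation fun s : Γ → ℤˣ =>
    (∏ α ∈ U, ((s α : ℤ) : ℂ)) •
      (normalizedTrace V).comp
        (∫ t₂ in (0 : ℝ)..t, ∫ t₁ in (0 : ℝ)..t₂,
          NormedSpace.exp ((t₁ : ℂ) • lindbladian H A y s))

end RandomLindblad

end

/-! The average over the signs is rewritten as a quantum expectation. In the basis of the monomials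
`∏ α ∈ S, s α`, multiplication by `s γ` toggles `γ` in `S`. So the terms `y s_γ H_γ` become fixed
operators `X γ` with square `w γ ^ 2`, where `w γ = |y| h γ`, and the sign average of the normalized
trace becomes a positive functional `ω`, the vector state of the empty monomial times the trace.
Since `K^a = A^a (1 + 2 Y_a)` with `Y_a = ∑ γ, b a γ • X γ`, the Lindbladians for all sign choices
combine into one generator `L`, and the quantity to bound is a double time integral of `ω_t (O z)`,
where `ω_t = ω ∘ exp (t L)` and `z` is multiplication by `∏ α ∈ U, s α` (`evolvedState_modeJump`).
Lindblad dynamics preserves positivity (`preservesPositivity_exp_gksl`), so Cauchy-Schwarz holds for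
every `ω_t`.

Smallness comes from the projections `p B` onto the monomials containing `B`. Initially `ω (p B) =
0` for nonempty `B`. As `p B` commutes with the `A^a`, `L (p B) = -2 ∑ a, [Y_a, [Y_a, p B]]`, and
only the `X β` with `β ∈ B` fail to commute with `p B`. This makes the growth rate proportional to a
bound `l` on `∑ a, b a β`, and the condition `∑ γ, b a γ * w γ ^ 2 ≤ 1 / 8` controls the terms
outside `B`. The estimate `norm_apply_sum_lie_lie_le` involves only sets with at most `|B|`
elements, so induction on `|B|` and Gronwall give `ω_t (p B) ≤ M ∏ α ∈ B, w α ^ 2` while `l t ≤ 1`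
(`evolvedState_proj_le`).

Finally, `z` toggles each mode of `U`, so each is excited either before or after: `z = ∑ B ⊆ U, p B
z p (U \ B)`. Cauchy-Schwarz bounds every summand by `M ‖O‖ ∏ α ∈ U, w α`
(`norm_evolvedState_mul_le`). -/

namespace RandomLindblad

/-! ### Positive functionals and their 2-seminorms -/

section PositiveFunctional

variable {𝓑 : Type*} [Ring 𝓑] [StarRing 𝓑] [Algebra ℂ 𝓑]

/-- A linear functional on a `*`-algebra that is Hermitian and nonnegative on the `star x * x`. -/
structure IsPositiveFunctional (ω : 𝓑 →ₗ[ℂ] ℂ) : Prop where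
  map_star : ∀ x, ω (star x) = star (ω x)
  nonneg : ∀ x, 0 ≤ (ω (star x * x)).re

/-- The `2`-seminorm `√ω(x* x)` of a functional `ω`. -/
noncomputable def twoNorm (ω : 𝓑 →ₗ[ℂ] ℂ) (x : 𝓑) : ℝ := √(ω (star x * x)).re

variable {ω : 𝓑 →ₗ[ℂ] ℂ}

theorem twoNorm_nonneg (x : 𝓑) : 0 ≤ twoNorm ω x := Real.sqrt_nonneg _

theorem IsPositiveFunctional.sq_twoNorm (hω : IsPositiveFunctional ω) (x : 𝓑) :
    twoNorm ω x ^ 2 = (ω (star x * x)).re := Real.sq_sqrt (hω.nonneg x)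

theorem twoNorm_zero : twoNorm ω 0 = 0 := by simp [twoNorm]

theorem twoNorm_mul_eq {u : 𝓑} {c : ℝ} (hc : 0 ≤ c) (hu : star u * u = ((c ^ 2 : ℝ) : ℂ) • 1)
    (x : 𝓑) : twoNorm ω (u * x) = c * twoNorm ω x := by
  have : star (u * x) * (u * x) = ((c ^ 2 : ℝ) : ℂ) • (star x * x) := by
    rw [star_mul, mul_assoc, ← mul_assoc (star u), hu]
    simp
  rw [twoNorm, this, map_smul, smul_eq_mul, Complex.re_ofReal_mul, Real.sqrt_mul (by positivity),
    Real.sqrt_sq hc, twoNorm]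

/-- The element `r` stands for a square root of `c ^ 2 - u* u`. Expressing the bound on `u` as an
algebraic identity lets it be used with any positive functional, without a C*-norm on `𝓑`. -/
theorem IsPositiveFunctional.twoNorm_mul_le (hω : IsPositiveFunctional ω) {u r : 𝓑} {c : ℝ}
    (hc : 0 ≤ c) (hu : star u * u + star r * r = ((c ^ 2 : ℝ) : ℂ) • 1)
    (x : 𝓑) : twoNorm ω (u * x) ≤ c * twoNorm ω x := by
  have h1 : star (u * x) * (u * x) + star (r * x) * (r * x)
      = ((c ^ 2 : ℝ) : ℂ) • (star x * x) := by
    have : star (u * x) * (u * x) + star (r * x) * (r * x)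
      = star x * (star u * u + star r * r) * x := by
      simp only [star_mul]; noncomm_ring
    rw [this, hu]
    simp
  have h2 := congrArg (fun z => (ω z).re) h1
  simp only [map_add, Complex.add_re, map_smul, smul_eq_mul, Complex.re_ofReal_mul] at h2
  have h3 := hω.nonneg (r * x)
  rw [twoNorm, twoNorm, ← Real.sqrt_sq hc, ← Real.sqrt_mul (by positivity)]
  apply Real.sqrt_le_sqrt
  linarith

variable [StarModule ℂ 𝓑]

/-- The pre-inner product `ω(x* y)` of a positive functional. -/
@[reducible]
noncomputable def IsPositiveFunctional.core (hω : IsPositiveFunctional ω) :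
    PreInnerProductSpace.Core ℂ 𝓑 where
  inner x y := ω (star x * y)
  conj_inner_symm x y := by
    have := hω.map_star (star y * x)
    simpa using this.symm
  re_inner_nonneg x := hω.nonneg x
  add_left x y z := by simp [add_mul]
  smul_left x y r := by simp

theorem IsPositiveFunctional.norm_apply_star_mul_le (hω : IsPositiveFunctional ω) (x y : 𝓑) :
    ‖ω (star x * y)‖ ≤ twoNorm ω x * twoNorm ω y :=
  @InnerProductSpace.Core.norm_inner_le_norm ℂ 𝓑 _ _ _ hω.core x y

theorem IsPositiveFunctional.twoNorm_add_le (hω : IsPositiveFunctional ω) (x y : 𝓑) :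
    twoNorm ω (x + y) ≤ twoNorm ω x + twoNorm ω y :=
  @norm_add_le 𝓑 (@InnerProductSpace.Core.toSeminormedAddCommGroup ℂ 𝓑 _ _ _
    hω.core).toSeminormedAddGroup x y

theorem twoNorm_smul (c : ℂ) (x : 𝓑) : twoNorm ω (c • x) = ‖c‖ * twoNorm ω x := by
  have : ω (star (c • x) * (c • x)) = ((‖c‖ ^ 2 : ℝ) : ℂ) * ω (star x * x) := by
    simp only [star_smul, smul_mul_smul_comm, map_smul, smul_eq_mul]
    congr 1
    rw [← Complex.normSq_eq_norm_sq, Complex.normSq_eq_conj_mul_self]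
    rfl
  rw [twoNorm, this, Complex.re_ofReal_mul, Real.sqrt_mul (by positivity),
    Real.sqrt_sq (norm_nonneg c), twoNorm]

theorem IsPositiveFunctional.twoNorm_sum_le (hω : IsPositiveFunctional ω) {ι : Type*}
    (s : Finset ι) (f : ι → 𝓑) : twoNorm ω (∑ i ∈ s, f i) ≤ ∑ i ∈ s, twoNorm ω (f i) := by
  classical
  induction s using Finset.induction_on with
  | empty => simp [twoNorm_zero]
  | insert i s hi ih =>
    rw [Finset.sum_insert hi, Finset.sum_insert hi]
    exact (hω.twoNorm_add_le _ _).trans (by gcongr)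

end PositiveFunctional

/-! ### Modes, their projections, and commutators with two excited modes -/

section ModeProjections

variable {𝓑 : Type*} [Ring 𝓑] [StarRing 𝓑] [Algebra ℂ 𝓑] {Γ : Type*} [DecidableEq Γ]

/-- Self-adjoint elements `X γ` that square to `w γ ^ 2` and pairwise commute or anticommute,
together with projections `p B` onto the vectors all of whose modes in `B` are excited; `X γ`
switches the mode `γ`. -/
structure ModeSystem (X : Γ → 𝓑) (w : Γ → ℝ) (p : Finset Γ → 𝓑) : Prop where
  strength_nonneg : ∀ γ, 0 ≤ w γ
  star_term : ∀ γ, star (X γ) = X γ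
  term_sq : ∀ γ, X γ * X γ = ((w γ ^ 2 : ℝ) : ℂ) • 1
  term_comm : ∀ γ γ', X γ * X γ' = X γ' * X γ ∨ X γ * X γ' = -(X γ' * X γ)
  proj_empty : p ∅ = 1
  star_proj : ∀ B, star (p B) = p B
  proj_mul : ∀ B B', p B * p B' = p (B ∪ B')
  term_proj_notMem : ∀ γ B, γ ∉ B → X γ * p B = p B * X γ
  term_proj_mem : ∀ γ B, γ ∈ B → X γ * p B = (p (B.erase γ) - p B) * X γ

namespace ModeSystem

variable {X : Γ → 𝓑} {w : Γ → ℝ} {p : Finset Γ → 𝓑} (S : ModeSystem X w p)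
include S

theorem proj_sq (B : Finset Γ) : p B * p B = p B := by rw [S.proj_mul, Finset.union_self]

theorem proj_mul_of_subset {B B' : Finset Γ} (h : B ⊆ B') : p B * p B' = p B' := by
  rw [S.proj_mul, Finset.union_eq_right.2 h]

theorem proj_mul_comm (B B' : Finset Γ) : p B * p B' = p B' * p B := by
  rw [S.proj_mul, S.proj_mul, Finset.union_comm]

theorem proj_term_mem {γ : Γ} {B : Finset Γ} (h : γ ∈ B) :
    p B * X γ = X γ * (p (B.erase γ) - p B) := by
  have := congrArg star (S.term_proj_mem γ B h)
  simpa [S.star_term, S.star_proj] using this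

theorem term_proj_eq_add {γ : Γ} {C : Finset Γ} (h : γ ∉ C) :
    X γ * p C = X γ * p (insert γ C) + p (insert γ C) * X γ := by
  rw [S.proj_term_mem (Finset.mem_insert_self γ C), Finset.erase_insert h]
  noncomm_ring

theorem star_proj_sub_mul_self {B B' : Finset Γ} (h : B ⊆ B') :
    star (p B - p B') * (p B - p B') = p B - p B' := by
  rw [star_sub, S.star_proj, S.star_proj, mul_sub, sub_mul, sub_mul, S.proj_sq, S.proj_sq,
    S.proj_mul_comm B' B, S.proj_mul_of_subset h]
  abel

variable {ω : 𝓑 →ₗ[ℂ] ℂ}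

theorem twoNorm_term_mul (γ : Γ) (x : 𝓑) : twoNorm ω (X γ * x) = w γ * twoNorm ω x :=
  twoNorm_mul_eq (S.strength_nonneg γ) (by rw [S.star_term, S.term_sq]) x

theorem sq_twoNorm_proj (hω : IsPositiveFunctional ω) (B : Finset Γ) :
    twoNorm ω (p B) ^ 2 = (ω (p B)).re := by
  rw [hω.sq_twoNorm, S.star_proj, S.proj_sq]

theorem twoNorm_proj_anti (hω : IsPositiveFunctional ω) {B B' : Finset Γ} (h : B ⊆ B') :
    twoNorm ω (p B') ≤ twoNorm ω (p B) := by
  have h2 := hω.nonneg (p B - p B')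
  rw [S.star_proj_sub_mul_self h, map_sub, Complex.sub_re, ← S.sq_twoNorm_proj hω, ← S.sq_twoNorm_proj hω] at h2
  exact (abs_le_of_sq_le_sq' (by linarith) (twoNorm_nonneg _)).2

theorem twoNorm_proj_sub_le (hω : IsPositiveFunctional ω) {B B' : Finset Γ} (h : B ⊆ B') :
    twoNorm ω (p B - p B') ≤ twoNorm ω (p B) := by
  have h2 := hω.sq_twoNorm (p B - p B')
  rw [S.star_proj_sub_mul_self h, map_sub, Complex.sub_re, ← S.sq_twoNorm_proj hω, ← S.sq_twoNorm_proj hω] at h2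
  exact (abs_le_of_sq_le_sq' (by nlinarith [sq_nonneg (twoNorm ω (p B'))]) (twoNorm_nonneg _)).2

theorem twoNorm_proj_mul_term_le (hω : IsPositiveFunctional ω) {γ : Γ} {B : Finset Γ}
    (h : γ ∈ B) : twoNorm ω (p B * X γ) ≤ w γ * twoNorm ω (p (B.erase γ)) := by
  rw [S.proj_term_mem h, S.twoNorm_term_mul]
  exact mul_le_mul_of_nonneg_left (S.twoNorm_proj_sub_le hω (Finset.erase_subset _ _))
    (S.strength_nonneg γ)

variable [StarModule ℂ 𝓑]

/-- For `γ ≠ γ'` the two projections can be exchanged, because they commute and each `X` commutes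
with the projection of the other mode. This leaves `p (insert γ C)` and `p (insert γ' C)` at the two
ends, so off-diagonal entries are small and only the diagonal costs `p C`. -/
theorem re_apply_proj_mul_term_le (hω : IsPositiveFunctional ω) {C : Finset Γ} {γ γ' : Γ}
    (h : γ ∉ C) (h' : γ' ∉ C) :
    ‖ω (star (p (insert γ C) * X γ) * (p (insert γ' C) * X γ'))‖ ≤
      (if γ = γ' then w γ ^ 2 * twoNorm ω (p C) ^ 2 else 0) +
      (w γ * twoNorm ω (p (insert γ C))) * (w γ' * twoNorm ω (p (insert γ' C))) := by
  split_ifs with e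
  · subst e
    refine (hω.norm_apply_star_mul_le _ _).trans ?_
    have h1 := S.twoNorm_proj_mul_term_le hω (Finset.mem_insert_self γ C)
    rw [Finset.erase_insert h] at h1
    have h2 := twoNorm_nonneg (ω := ω) (p (insert γ C) * X γ)
    nlinarith [mul_self_nonneg (w γ * twoNorm ω (p (insert γ C)))]
  · have hγ : γ ∉ insert γ' C := by simp [e, h]
    have hγ' : γ' ∉ insert γ C := by simp [Ne.symm e, h']
    have : star (p (insert γ C) * X γ) * (p (insert γ' C) * X γ')
        = star (X γ * p (insert γ' C)) * (X γ' * p (insert γ C)) := by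
      rw [star_mul, star_mul, S.star_term, S.star_proj, S.star_proj]
      calc X γ * p (insert γ C) * (p (insert γ' C) * X γ')
          = X γ * (p (insert γ C) * p (insert γ' C)) * X γ' := by noncomm_ring
        _ = (X γ * p (insert γ' C)) * (p (insert γ C) * X γ') := by
            rw [S.proj_mul_comm]; noncomm_ring
        _ = _ := by rw [S.term_proj_notMem _ _ hγ, S.term_proj_notMem _ _ hγ']
    rw [this, zero_add]
    refine (hω.norm_apply_star_mul_le _ _).trans_eq ?_
    rw [S.twoNorm_term_mul, S.twoNorm_term_mul]
    ring

/-- Expanding the square, the diagonal gives the sum of squares and the rest factors as a perfect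
square. The weight of `C` itself thus enters with an `ℓ²` norm of the coefficients rather than an
`ℓ¹` norm, which the local energy could not control. -/
theorem twoNorm_sum_proj_mul_term_le (hω : IsPositiveFunctional ω) (C s : Finset Γ)
    (hs : ∀ γ ∈ s, γ ∉ C) (v : Γ → ℝ) :
    twoNorm ω (∑ γ ∈ s, (v γ : ℂ) • (p (insert γ C) * X γ)) ≤
      √(∑ γ ∈ s, v γ ^ 2 * w γ ^ 2) * twoNorm ω (p C)
        + ∑ γ ∈ s, |v γ| * w γ * twoNorm ω (p (insert γ C)) := by
  set A := ∑ γ ∈ s, v γ ^ 2 * w γ ^ 2 with hA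
  set D := ∑ γ ∈ s, |v γ| * w γ * twoNorm ω (p (insert γ C)) with hD
  have hA0 : 0 ≤ A := Finset.sum_nonneg fun γ _ => by positivity
  have hD0 : 0 ≤ D := Finset.sum_nonneg fun γ _ =>
    mul_nonneg (mul_nonneg (abs_nonneg _) (S.strength_nonneg γ)) (twoNorm_nonneg _)
  have key : twoNorm ω (∑ γ ∈ s, (v γ : ℂ) • (p (insert γ C) * X γ)) ^ 2
      ≤ A * twoNorm ω (p C) ^ 2 + D ^ 2 := by
    rw [hω.sq_twoNorm, star_sum, Finset.sum_mul_sum, map_sum, Complex.re_sum, hA, hD, sq (∑ γ ∈ s, _),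
      Finset.sum_mul_sum, Finset.sum_mul, ← Finset.sum_add_distrib]
    refine Finset.sum_le_sum fun γ hγ => ?_
    rw [map_sum, Complex.re_sum]
    have : v γ ^ 2 * w γ ^ 2 * twoNorm ω (p C) ^ 2
        = ∑ γ' ∈ s, |v γ| * |v γ'| * (if γ = γ' then w γ ^ 2 * twoNorm ω (p C) ^ 2 else 0) := by
      simp only [mul_ite, mul_zero, Finset.sum_ite_eq, hγ, if_true]
      rw [← sq, sq_abs]; ring
    rw [this, ← Finset.sum_add_distrib]
    refine Finset.sum_le_sum fun γ' hγ' => ?_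
    have h1 := S.re_apply_proj_mul_term_le hω (hs γ hγ) (hs γ' hγ')
    refine (Complex.re_le_norm _).trans ?_
    rw [star_smul, smul_mul_smul_comm, map_smul, norm_smul, norm_mul, norm_star, Complex.norm_real,
      Complex.norm_real, Real.norm_eq_abs, Real.norm_eq_abs]
    refine (mul_le_mul_of_nonneg_left h1 (by positivity)).trans_eq ?_
    ring
  have h2 : A * twoNorm ω (p C) ^ 2 + D ^ 2 ≤ (√A * twoNorm ω (p C) + D) ^ 2 := by
    have := Real.sq_sqrt hA0
    have h3 : 0 ≤ √A * twoNorm ω (p C) * D :=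
      mul_nonneg (mul_nonneg (Real.sqrt_nonneg _) (twoNorm_nonneg _)) hD0
    nlinarith
  exact (abs_le_of_sq_le_sq' (key.trans h2)
    (add_nonneg (mul_nonneg (Real.sqrt_nonneg _) (twoNorm_nonneg _)) hD0)).2

theorem twoNorm_sum_term_mul_proj_le (hω : IsPositiveFunctional ω) (C s : Finset Γ)
    (hs : ∀ γ ∈ s, γ ∉ C) (v : Γ → ℝ) :
    twoNorm ω ((∑ γ ∈ s, (v γ : ℂ) • X γ) * p C) ≤
      √(∑ γ ∈ s, v γ ^ 2 * w γ ^ 2) * twoNorm ω (p C)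
        + 2 * ∑ γ ∈ s, |v γ| * w γ * twoNorm ω (p (insert γ C)) := by
  have : (∑ γ ∈ s, (v γ : ℂ) • X γ) * p C
      = ∑ γ ∈ s, (v γ : ℂ) • (X γ * p (insert γ C))
        + ∑ γ ∈ s, (v γ : ℂ) • (p (insert γ C) * X γ) := by
    rw [Finset.sum_mul, ← Finset.sum_add_distrib]
    refine Finset.sum_congr rfl fun γ hγ => ?_
    rw [smul_mul_assoc, S.term_proj_eq_add (hs γ hγ), smul_add]
  rw [this]
  refine (hω.twoNorm_add_le _ _).trans ?_
  have h1 := S.twoNorm_sum_proj_mul_term_le hω C s hs v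
  have h2 : twoNorm ω (∑ γ ∈ s, (v γ : ℂ) • (X γ * p (insert γ C)))
      ≤ ∑ γ ∈ s, |v γ| * w γ * twoNorm ω (p (insert γ C)) := by
    refine (hω.twoNorm_sum_le _ _).trans_eq (Finset.sum_congr rfl fun γ _ => ?_)
    rw [twoNorm_smul, S.twoNorm_term_mul, Complex.norm_real, Real.norm_eq_abs]
    ring
  linarith

/-- Both terms of the double commutator act on excited modes. -/
theorem norm_apply_lie_term_lie_term_le (hω : IsPositiveFunctional ω) {B : Finset Γ} {q r : ℝ}
    (hq : ∀ B' : Finset Γ, B'.card < B.card → twoNorm ω (p B') ≤ q * ∏ α ∈ B', w α)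
    (hr : twoNorm ω (p B) ≤ r * ∏ α ∈ B, w α) (hq0 : 0 ≤ q) (hr0 : 0 ≤ r)
    {β γ : Γ} (hβ : β ∈ B) (hγ : γ ∈ B) :
    ‖ω ⁅X γ, ⁅X β, p B⁆⁆‖ ≤ (2 * q * r + 4 * q ^ 2) * (∏ α ∈ B, w α) ^ 2 := by
  have hw : ∀ B' : Finset Γ, 0 ≤ ∏ α ∈ B', w α := fun B' =>
    Finset.prod_nonneg fun α _ => S.strength_nonneg α
  have her : ∀ δ ∈ B, w δ * twoNorm ω (p (B.erase δ)) ≤ q * ∏ α ∈ B, w α := by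
    intro δ hδ
    have h1 := mul_le_mul_of_nonneg_left (hq _ (Finset.card_erase_lt_of_mem hδ))
      (S.strength_nonneg δ)
    refine h1.trans_eq ?_
    rw [← Finset.mul_prod_erase B w hδ]; ring
  have her0 : ∀ δ, 0 ≤ w δ * twoNorm ω (p (B.erase δ)) := fun δ =>
    mul_nonneg (S.strength_nonneg δ) (twoNorm_nonneg _)
  -- Both sides of `p B` carry a term that removes a mode, so each factor loses one element of `B`
  -- and is controlled by `q`.
  have hmid : ∀ δ ∈ B, ∀ ε ∈ B, ‖ω (X δ * p B * X ε)‖ ≤ q ^ 2 * (∏ α ∈ B, w α) ^ 2 := by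
    intro δ hδ ε hε
    have : X δ * p B * X ε = star (p B * X δ) * (p B * X ε) := by
      rw [star_mul, S.star_term, S.star_proj, mul_assoc (X δ) (p B) (p B * X ε),
        ← mul_assoc (p B) (p B), S.proj_sq, ← mul_assoc]
    rw [this]
    refine (hω.norm_apply_star_mul_le _ _).trans ?_
    calc twoNorm ω (p B * X δ) * twoNorm ω (p B * X ε)
        ≤ (q * ∏ α ∈ B, w α) * (q * ∏ α ∈ B, w α) := by
          apply mul_le_mul ((S.twoNorm_proj_mul_term_le hω hδ).trans (her δ hδ))
            ((S.twoNorm_proj_mul_term_le hω hε).trans (her ε hε)) (twoNorm_nonneg _)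
            (mul_nonneg hq0 (hw _))
      _ = _ := by ring
  have hside : ∀ δ ∈ B, ∀ ε ∈ B,
      ‖ω (X δ * X ε * p B)‖ ≤ (q * r + q ^ 2) * (∏ α ∈ B, w α) ^ 2 := by
    intro δ hδ ε hε
    have hW := hw B
    by_cases e : δ = ε
    · subst e
      have : X δ * X δ * p B = star (X δ * p B) * (X δ * p B) := by
        rw [star_mul, S.star_term, S.star_proj, S.term_sq, mul_assoc (p B), ← mul_assoc (X δ),
          S.term_sq]
        simp [S.proj_sq]
      rw [this]
      refine (hω.norm_apply_star_mul_le _ _).trans ?_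
      rw [S.twoNorm_term_mul]
      have h1 := (mul_le_mul_of_nonneg_left
        (S.twoNorm_proj_anti hω (Finset.erase_subset δ B)) (S.strength_nonneg δ)).trans (her δ hδ)
      have h0 : 0 ≤ w δ * twoNorm ω (p B) := mul_nonneg (S.strength_nonneg δ) (twoNorm_nonneg _)
      calc _ ≤ (q * ∏ α ∈ B, w α) * (q * ∏ α ∈ B, w α) :=
            mul_le_mul h1 h1 h0 (mul_nonneg hq0 hW)
        _ ≤ _ := by nlinarith [mul_nonneg (mul_nonneg hq0 hr0) (sq_nonneg (∏ α ∈ B, w α))]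
    · have hε' : ε ∈ B.erase δ := Finset.mem_erase.2 ⟨Ne.symm e, hε⟩
      have hδ' : δ ∉ (B.erase δ).erase ε := by simp
      have hε'' : ε ∉ (B.erase δ).erase ε := by simp
      -- A copy of `p D` is split off from `p B` and moved to the left through both terms. The
      -- missing factors `w δ * w ε` of `D` are supplied by the terms themselves.
      set D := (B.erase δ).erase ε with hD
      have hDB : D ⊆ B := (Finset.erase_subset _ _).trans (Finset.erase_subset _ _)
      have : X δ * X ε * p B = star (X δ * p D) * (X ε * p B) := by
        rw [star_mul, S.star_term, S.star_proj]
        calc X δ * X ε * p B = X δ * (X ε * p D) * p B := by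
              rw [mul_assoc, mul_assoc, mul_assoc, S.proj_mul_of_subset hDB]
          _ = (X δ * p D) * (X ε * p B) := by
              rw [S.term_proj_notMem _ _ hε'']; noncomm_ring
          _ = _ := by rw [S.term_proj_notMem _ _ hδ']
      rw [this]
      refine (hω.norm_apply_star_mul_le _ _).trans ?_
      rw [S.twoNorm_term_mul, S.twoNorm_term_mul]
      have hDc : D.card < B.card :=
        (Finset.card_erase_lt_of_mem hε').trans (Finset.card_erase_lt_of_mem hδ)
      have h1 := hq D hDc
      have h2 : (∏ α ∈ B, w α) = w δ * w ε * ∏ α ∈ D, w α := by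
        rw [← Finset.mul_prod_erase B w hδ, ← Finset.mul_prod_erase _ w hε', mul_assoc]
      calc w δ * twoNorm ω (p D) * (w ε * twoNorm ω (p B))
          = w δ * w ε * (twoNorm ω (p D) * twoNorm ω (p B)) := by ring
        _ ≤ w δ * w ε * ((q * ∏ α ∈ D, w α) * (r * ∏ α ∈ B, w α)) := by
            apply mul_le_mul_of_nonneg_left _
              (mul_nonneg (S.strength_nonneg _) (S.strength_nonneg _))
            exact mul_le_mul h1 hr (twoNorm_nonneg _) (mul_nonneg hq0 (hw _))
        _ = q * r * (∏ α ∈ B, w α) ^ 2 := by rw [sq, h2]; ring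
        _ ≤ _ := by nlinarith [mul_nonneg (sq_nonneg q) (sq_nonneg (∏ α ∈ B, w α))]
  have hside' : ∀ δ ∈ B, ∀ ε ∈ B,
      ‖ω (p B * X δ * X ε)‖ ≤ (q * r + q ^ 2) * (∏ α ∈ B, w α) ^ 2 := by
    intro δ hδ ε hε
    have h1 := hω.map_star (X ε * X δ * p B)
    simp only [star_mul, S.star_term, S.star_proj] at h1
    rw [mul_assoc, h1, norm_star]
    exact hside ε hε δ hδ
  have e : ⁅X γ, ⁅X β, p B⁆⁆ = X γ * X β * p B - X γ * p B * X β - X β * p B * X γ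
      + p B * X β * X γ := by
    simp only [Ring.lie_def]; noncomm_ring
  rw [e, map_add, map_sub, map_sub]
  refine (norm_add_le _ _).trans ?_
  have i1 := norm_sub_le (ω (X γ * X β * p B) - ω (X γ * p B * X β)) (ω (X β * p B * X γ))
  have i2 := norm_sub_le (ω (X γ * X β * p B)) (ω (X γ * p B * X β))
  have := hside γ hγ β hβ
  have := hside' β hβ γ hγ
  have := hmid γ hγ β hβ
  have := hmid β hβ γ hγ
  nlinarith

end ModeSystem

end ModeProjections

end RandomLindblad

/-! ### The double commutator with all modes -/

namespace RandomLindblad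

attribute [local instance] LieRing.ofAssociativeRing

namespace ModeSystem

variable {𝓑 : Type*} [Ring 𝓑] [StarRing 𝓑] [Algebra ℂ 𝓑] {Γ : Type*} [DecidableEq Γ]
  {X : Γ → 𝓑} {w : Γ → ℝ} {p : Finset Γ → 𝓑} (S : ModeSystem X w p)
include S

/-- The number `e` treats both cases at once: commuting terms drop out of the commutator, and a sum
weighted by `e` anticommutes with `X β`. -/
theorem lie_term (β γ : Γ) : ∃ e : ℝ, (e = 0 ∨ e = 2) ∧
    ⁅X γ, X β⁆ = (e : ℂ) • (X γ * X β) ∧ (e : ℂ) • (X β * X γ) = -((e : ℂ) • (X γ * X β)) := by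
  rcases S.term_comm γ β with h | h
  · exact ⟨0, Or.inl rfl, by simp [Ring.lie_def, h], by simp⟩
  · refine ⟨2, Or.inr rfl, ?_, ?_⟩
    · rw [Ring.lie_def, h, ← neg_eq_iff_eq_neg.2 h]
      simp [two_smul, sub_eq_add_neg]
    · rw [h]; simp

variable {ω : 𝓑 →ₗ[ℂ] ℂ} [StarModule ℂ 𝓑]

/-- One of the terms of the double commutator acts on an excited mode, the other ones, weighted by
`c`, act outside of the excited modes. -/
theorem norm_apply_lie_lie_sum_term_le (hω : IsPositiveFunctional ω) {B : Finset Γ} {q r : ℝ}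
    (hq : ∀ B' : Finset Γ, B'.card < B.card → twoNorm ω (p B') ≤ q * ∏ α ∈ B', w α)
    (hr : ∀ B' : Finset Γ, B'.card = B.card → twoNorm ω (p B') ≤ r * ∏ α ∈ B', w α)
    (hq0 : 0 ≤ q) (hr0 : 0 ≤ r) {β : Γ} (hβ : β ∈ B) (s : Finset Γ) (hs : ∀ γ ∈ s, γ ∉ B)
    {c : Γ → ℝ} (hc0 : ∀ γ, 0 ≤ c γ) (hc1 : ∀ γ, c γ ≤ 1)
    (hcw : ∑ γ ∈ s, c γ * w γ ^ 2 ≤ 1 / 8) :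
    ‖ω ⁅⁅∑ γ ∈ s, (c γ : ℂ) • X γ, X β⁆, p B⁆‖ ≤ (r ^ 2 + 2 * q * r) * (∏ α ∈ B, w α) ^ 2 := by
  have hw : ∀ B' : Finset Γ, 0 ≤ ∏ α ∈ B', w α := fun B' =>
    Finset.prod_nonneg fun α _ => S.strength_nonneg α
  choose e he he1 he2 using S.lie_term β
  set C := B.erase β with hC
  have hCB : C ⊆ B := Finset.erase_subset _ _
  have hsC : ∀ γ ∈ s, γ ∉ C := fun γ hγ h => hs γ hγ (hCB h)
  have he0 : ∀ γ, 0 ≤ e γ := fun γ => by rcases he γ with h | h <;> simp [h]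
  have he2' : ∀ γ, e γ ≤ 2 := fun γ => by rcases he γ with h | h <;> simp [h]
  set v : Γ → ℝ := fun γ => c γ * e γ with hv
  have hv0 : ∀ γ, 0 ≤ v γ := fun γ => mul_nonneg (hc0 γ) (he0 γ)
  have hvle : ∀ γ, v γ ≤ 2 * c γ := fun γ => by
    have := mul_le_mul_of_nonneg_left (he2' γ) (hc0 γ); simp only [hv]; linarith
  set Y := ∑ γ ∈ s, (v γ : ℂ) • X γ with hY
  have hW : ⁅∑ γ ∈ s, (c γ : ℂ) • X γ, X β⁆ = Y * X β := by
    rw [sum_lie, hY, Finset.sum_mul]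
    refine Finset.sum_congr rfl fun γ _ => ?_
    rw [smul_lie, he1, smul_smul, smul_mul_assoc]
    simp [hv]
  have hYs : star Y = Y := by
    simp [hY, star_sum, S.star_term]
  have hYX : X β * Y = -(Y * X β) := by
    rw [hY, Finset.sum_mul, Finset.mul_sum, ← Finset.sum_neg_distrib]
    refine Finset.sum_congr rfl fun γ _ => ?_
    rw [smul_mul_assoc, mul_smul_comm]
    simp only [hv, Complex.ofReal_mul, mul_smul, he2, smul_neg]
  have hYp : Y * p C = p C * Y := by
    rw [hY, Finset.sum_mul, Finset.mul_sum]
    refine Finset.sum_congr rfl fun γ hγ => ?_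
    rw [smul_mul_assoc, mul_smul_comm, S.term_proj_notMem _ _ (hsC γ hγ)]
  -- `Y` anticommutes with `X β`, so the two halves of the outer commutator are adjoint to each
  -- other up to sign and one estimate suffices.
  have h1 : ω (p B * (Y * X β)) = -star (ω (Y * X β * p B)) := by
    rw [← hω.map_star]
    simp only [star_mul, S.star_proj, S.star_term, hYs, hYX]
    simp
  have h2 : ‖ω ⁅⁅∑ γ ∈ s, (c γ : ℂ) • X γ, X β⁆, p B⁆‖ ≤ 2 * ‖ω (Y * X β * p B)‖ := by
    rw [hW, Ring.lie_def, map_sub, h1]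
    refine (norm_sub_le _ _).trans_eq ?_
    rw [norm_neg, norm_star]; ring
  have h3 : Y * X β * p B = star (Y * p C) * (X β * p B) := by
    have hn : β ∉ C := Finset.notMem_erase β B
    rw [star_mul, S.star_proj, hYs]
    calc Y * X β * p B = Y * (X β * p C) * p B := by
          rw [mul_assoc, mul_assoc, mul_assoc, S.proj_mul_of_subset hCB]
      _ = (Y * p C) * (X β * p B) := by
          rw [S.term_proj_notMem _ _ hn]; noncomm_ring
      _ = _ := by rw [hYp]
  have hBC : (∏ α ∈ B, w α) = w β * ∏ α ∈ C, w α := (Finset.mul_prod_erase B w hβ).symm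
  have hCcard : C.card < B.card := Finset.card_erase_lt_of_mem hβ
  -- Here `1 / 8` is used twice: `v ^ 2 ≤ 4 c` makes the `ℓ²` coefficient at most `1`, and `v ≤ 2 c`
  -- makes the remaining sum at most `r / 2`. The sets `insert γ C` again have `|B|` elements, so no
  -- larger sets enter.
  have h4 : twoNorm ω (Y * p C) ≤ (q + r / 2) * ∏ α ∈ C, w α := by
    refine (S.twoNorm_sum_term_mul_proj_le hω C s hsC v).trans ?_
    have i1 : √(∑ γ ∈ s, v γ ^ 2 * w γ ^ 2) ≤ 1 := by
      rw [Real.sqrt_le_one]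
      have : ∑ γ ∈ s, v γ ^ 2 * w γ ^ 2 ≤ ∑ γ ∈ s, 4 * (c γ * w γ ^ 2) := by
        refine Finset.sum_le_sum fun γ _ => ?_
        have : v γ ^ 2 ≤ 4 * c γ := by nlinarith [hv0 γ, hvle γ, hc0 γ, hc1 γ]
        nlinarith [sq_nonneg (w γ)]
      rw [← Finset.mul_sum] at this
      linarith
    have i2 : ∑ γ ∈ s, |v γ| * w γ * twoNorm ω (p (insert γ C))
        ≤ ∑ γ ∈ s, 2 * (c γ * w γ ^ 2) * (r * ∏ α ∈ C, w α) := by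
      refine Finset.sum_le_sum fun γ hγ => ?_
      have hcard : (insert γ C).card = B.card := by
        rw [Finset.card_insert_of_notMem (hsC γ hγ), hC, Finset.card_erase_add_one hβ]
      have j1 := hr _ hcard
      rw [Finset.prod_insert (hsC γ hγ)] at j1
      rw [abs_of_nonneg (hv0 γ)]
      calc v γ * w γ * twoNorm ω (p (insert γ C))
          ≤ (2 * c γ) * w γ * (r * (w γ * ∏ α ∈ C, w α)) := by
            apply mul_le_mul _ j1 (twoNorm_nonneg _)
              (mul_nonneg (mul_nonneg zero_le_two (hc0 γ)) (S.strength_nonneg γ))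
            exact mul_le_mul_of_nonneg_right (hvle γ) (S.strength_nonneg γ)
        _ = _ := by ring
    rw [← Finset.sum_mul, ← Finset.mul_sum] at i2
    have i3 := hq C hCcard
    have i4 : √(∑ γ ∈ s, v γ ^ 2 * w γ ^ 2) * twoNorm ω (p C) ≤ 1 * (q * ∏ α ∈ C, w α) :=
      mul_le_mul i1 i3 (twoNorm_nonneg _) zero_le_one
    have i5 : 0 ≤ r * ∏ α ∈ C, w α := mul_nonneg hr0 (hw _)
    nlinarith
  have h5 : ‖ω (Y * X β * p B)‖ ≤ ((q + r / 2) * r) * (∏ α ∈ B, w α) ^ 2 := by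
    rw [h3]
    refine (hω.norm_apply_star_mul_le _ _).trans ?_
    rw [S.twoNorm_term_mul]
    calc twoNorm ω (Y * p C) * (w β * twoNorm ω (p B))
        ≤ ((q + r / 2) * ∏ α ∈ C, w α) * (w β * (r * ∏ α ∈ B, w α)) := by
          apply mul_le_mul h4 _ (mul_nonneg (S.strength_nonneg _) (twoNorm_nonneg _))
            (mul_nonneg (by positivity) (hw _))
          exact mul_le_mul_of_nonneg_left (hr B rfl) (S.strength_nonneg _)
      _ = _ := by rw [sq, hBC]; ring
  linarith

/-- The terms outside `B` commute with `p B`, so the inner commutator only sees `β ∈ B`; by the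
Leibniz rule the outer terms then act through `⁅⁅Yo, X β⁆, p B⁆`. Every contribution keeps a factor
`c β` with `β ∈ B`, which is what keeps the later sum over the jumps bounded. -/
theorem norm_apply_lie_sum_lie_sum_le [Fintype Γ] (hω : IsPositiveFunctional ω) {B : Finset Γ}
    {q r : ℝ}
    (hq : ∀ B' : Finset Γ, B'.card < B.card → twoNorm ω (p B') ≤ q * ∏ α ∈ B', w α)
    (hr : ∀ B' : Finset Γ, B'.card = B.card → twoNorm ω (p B') ≤ r * ∏ α ∈ B', w α)
    (hq0 : 0 ≤ q) (hr0 : 0 ≤ r)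
    {c : Γ → ℝ} (hc0 : ∀ γ, 0 ≤ c γ) (hc1 : ∀ γ, c γ ≤ 1) (hcw : ∑ γ, c γ * w γ ^ 2 ≤ 1 / 8) :
    ‖ω ⁅∑ γ, (c γ : ℂ) • X γ, ⁅∑ γ, (c γ : ℂ) • X γ, p B⁆⁆‖ ≤
      (∑ β ∈ B, c β) * (6 * B.card * (r ^ 2 + q ^ 2) * (∏ α ∈ B, w α) ^ 2) := by
  set Yi := ∑ γ ∈ B, (c γ : ℂ) • X γ with hYi
  set Yo := ∑ γ ∈ Bᶜ, (c γ : ℂ) • X γ with hYo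
  have hsplit : ∑ γ, (c γ : ℂ) • X γ = Yi + Yo := (Finset.sum_add_sum_compl B _).symm
  have hYo0 : ⁅Yo, p B⁆ = 0 := by
    rw [hYo, sum_lie]
    refine Finset.sum_eq_zero fun γ hγ => ?_
    rw [smul_lie, Ring.lie_def, S.term_proj_notMem _ _ (Finset.mem_compl.1 hγ), sub_self,
      smul_zero]
  have h1 : ⁅∑ γ, (c γ : ℂ) • X γ, ⁅∑ γ, (c γ : ℂ) • X γ, p B⁆⁆
      = ∑ β ∈ B, (c β : ℂ) • (∑ γ ∈ B, (c γ : ℂ) • ⁅X γ, ⁅X β, p B⁆⁆ + ⁅⁅Yo, X β⁆, p B⁆) := by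
    rw [hsplit, add_lie Yi Yo (p B), hYo0, add_zero, hYi, sum_lie, lie_sum]
    refine Finset.sum_congr rfl fun β _ => ?_
    rw [smul_lie, lie_smul, add_lie, leibniz_lie Yo, hYo0, lie_zero, add_zero, sum_lie]
    simp only [smul_lie]
  have hw2 : 0 ≤ (∏ α ∈ B, w α) ^ 2 := sq_nonneg _
  have hcw' : ∑ γ ∈ Bᶜ, c γ * w γ ^ 2 ≤ 1 / 8 :=
    (Finset.sum_le_sum_of_subset_of_nonneg (Finset.subset_univ _)
      fun γ _ _ => mul_nonneg (hc0 γ) (sq_nonneg _)).trans hcw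
  rw [h1, map_sum, Finset.sum_mul]
  refine (norm_sum_le _ _).trans (Finset.sum_le_sum fun β hβ => ?_)
  rw [map_smul, norm_smul, Complex.norm_real, Real.norm_of_nonneg (hc0 β)]
  refine mul_le_mul_of_nonneg_left ?_ (hc0 β)
  rw [map_add, map_sum]
  have i1 := S.norm_apply_lie_lie_sum_term_le hω hq hr hq0 hr0 hβ Bᶜ
    (fun γ hγ => Finset.mem_compl.1 hγ) hc0 hc1 hcw'
  have i2 : ‖∑ γ ∈ B, ω ((c γ : ℂ) • ⁅X γ, ⁅X β, p B⁆⁆)‖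
      ≤ B.card * ((2 * q * r + 4 * q ^ 2) * (∏ α ∈ B, w α) ^ 2) := by
    rw [← nsmul_eq_mul]
    refine (norm_sum_le _ _).trans (Finset.sum_le_card_nsmul _ _ _ fun γ hγ => ?_)
    rw [map_smul, norm_smul, Complex.norm_real, Real.norm_of_nonneg (hc0 γ)]
    have := S.norm_apply_lie_term_lie_term_le hω hq (hr B rfl) hq0 hr0 hβ hγ
    have := mul_le_mul (hc1 γ) this (norm_nonneg _) zero_le_one
    linarith
  refine (norm_add_le _ _).trans ((add_le_add i2 i1).trans ?_)
  have hcard : (1 : ℝ) ≤ B.card := by exact_mod_cast Finset.card_pos.2 ⟨β, hβ⟩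
  rw [← mul_assoc, ← add_mul]
  refine mul_le_mul_of_nonneg_right ?_ hw2
  have k1 : 2 * q * r ≤ q ^ 2 + r ^ 2 := two_mul_le_add_sq q r
  have k2 : r ^ 2 + 2 * q * r ≤ B.card * (q ^ 2 + 2 * r ^ 2) := by
    nlinarith [mul_nonneg (sub_nonneg.2 hcard) (by positivity : 0 ≤ q ^ 2 + 2 * r ^ 2)]
  have k3 := mul_le_mul_of_nonneg_left k1 (zero_le_one.trans hcard)
  nlinarith [mul_nonneg (zero_le_one.trans hcard) (sq_nonneg r)]

/-- The growth rate of the weight of the modes `B` under the dissipative dynamics. -/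
theorem norm_apply_sum_lie_lie_le [Fintype Γ] {J : Type*} [Fintype J]
    (hω : IsPositiveFunctional ω) {B : Finset Γ} {q r : ℝ}
    (hq : ∀ B' : Finset Γ, B'.card < B.card → twoNorm ω (p B') ≤ q * ∏ α ∈ B', w α)
    (hr : ∀ B' : Finset Γ, B'.card = B.card → twoNorm ω (p B') ≤ r * ∏ α ∈ B', w α)
    (hq0 : 0 ≤ q) (hr0 : 0 ≤ r) {c : J → Γ → ℝ} {l : ℝ}
    (hc0 : ∀ a γ, 0 ≤ c a γ) (hc1 : ∀ a γ, c a γ ≤ 1) (hcw : ∀ a, ∑ γ, c a γ * w γ ^ 2 ≤ 1 / 8)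
    (hl : ∀ γ, ∑ a, c a γ ≤ l) :
    ‖ω (∑ a, (-2 : ℂ) • ⁅∑ γ, (c a γ : ℂ) • X γ, ⁅∑ γ, (c a γ : ℂ) • X γ, p B⁆⁆)‖ ≤
      l * (12 * B.card ^ 2) * (r ^ 2 + q ^ 2) * (∏ α ∈ B, w α) ^ 2 := by
  rw [map_sum]
  refine (norm_sum_le _ _).trans ?_
  calc _ ≤ ∑ a, (∑ β ∈ B, c a β) *
          (2 * (6 * B.card * (r ^ 2 + q ^ 2) * (∏ α ∈ B, w α) ^ 2)) := by
        refine Finset.sum_le_sum fun a _ => ?_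
        rw [map_smul, norm_smul, norm_neg, Complex.norm_ofNat]
        have := S.norm_apply_lie_sum_lie_sum_le hω hq hr hq0 hr0 (hc0 a) (hc1 a) (hcw a)
        linarith
    _ = (∑ β ∈ B, ∑ a, c a β) *
          (2 * (6 * B.card * (r ^ 2 + q ^ 2) * (∏ α ∈ B, w α) ^ 2)) := by
        rw [← Finset.sum_mul, Finset.sum_comm]
    _ ≤ (B.card * l) * (2 * (6 * B.card * (r ^ 2 + q ^ 2) * (∏ α ∈ B, w α) ^ 2)) := by
        refine mul_le_mul_of_nonneg_right ?_ (by positivity)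
        rw [← nsmul_eq_mul]
        exact Finset.sum_le_card_nsmul _ _ _ fun γ _ => hl γ
    _ = _ := by ring

end ModeSystem

end RandomLindblad

/-! ### Lindblad dynamics preserves positivity -/

namespace RandomLindblad

open NormedSpace Filter Topology

section Semigroup

variable {𝓑 : Type*} [NormedRing 𝓑] [NormedAlgebra ℂ 𝓑]

theorem exp_apply_of_apply_eq_zero [CompleteSpace 𝓑] {Φ : 𝓑 →L[ℂ] 𝓑} {x : 𝓑} (h : Φ x = 0) :
    NormedSpace.exp Φ x = x := by
  have h1 := (exp_series_hasSum_exp' (𝕂 := ℂ) Φ).mapL (ContinuousLinearMap.apply ℂ 𝓑 x)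
  have h2 := hasSum_single (f := fun n : ℕ => (ContinuousLinearMap.apply ℂ 𝓑 x)
    (((n.factorial : ℂ)⁻¹) • Φ ^ n)) 0 (fun n hn => by
      obtain ⟨m, rfl⟩ := Nat.exists_eq_succ_of_ne_zero hn
      simp [pow_succ, h])
  simpa using h1.unique h2

theorem hasDerivAt_apply_exp [CompleteSpace 𝓑] (ω : 𝓑 →L[ℂ] ℂ) (Φ : 𝓑 →L[ℂ] 𝓑) (x : 𝓑) (t : ℝ) :
    HasDerivAt (fun s : ℝ => (ω (NormedSpace.exp ((s : ℂ) • Φ) x)).re)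
      (ω (NormedSpace.exp ((t : ℂ) • Φ) (Φ x))).re t := by
  have h1 := hasDerivAt_exp_smul_const (𝕂 := ℂ) Φ (t : ℂ)
  have h2 := (ω.comp (ContinuousLinearMap.apply ℂ 𝓑 x)).hasFDerivAt.comp_hasDerivAt (t : ℂ) h1
  exact h2.real_of_complex

variable [StarRing 𝓑]

/-- A bounded map under which the pullback of every positive functional is positive. -/
def PreservesPositivity (Φ : 𝓑 →L[ℂ] 𝓑) : Prop :=
  ∀ ω : 𝓑 →L[ℂ] ℂ, IsPositiveFunctional (ω : 𝓑 →ₗ[ℂ] ℂ) →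
    IsPositiveFunctional ((ω.comp Φ : 𝓑 →L[ℂ] ℂ) : 𝓑 →ₗ[ℂ] ℂ)

namespace PreservesPositivity

variable {Φ Ψ : 𝓑 →L[ℂ] 𝓑}

theorem one : PreservesPositivity (1 : 𝓑 →L[ℂ] 𝓑) := fun _ h => h

theorem zero : PreservesPositivity (0 : 𝓑 →L[ℂ] 𝓑) := fun _ _ => ⟨by simp, by simp⟩

theorem mul (hΦ : PreservesPositivity Φ) (hΨ : PreservesPositivity Ψ) :
    PreservesPositivity (Φ * Ψ) := fun ω h => hΨ (ω.comp Φ) (hΦ ω h)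

theorem pow (hΦ : PreservesPositivity Φ) (n : ℕ) : PreservesPositivity (Φ ^ n) := by
  induction n with
  | zero => exact one
  | succ n ih => rw [pow_succ]; exact ih.mul hΦ

theorem add (hΦ : PreservesPositivity Φ) (hΨ : PreservesPositivity Ψ) :
    PreservesPositivity (Φ + Ψ) := fun ω h => by
  refine ⟨fun x => ?_, fun x => ?_⟩
  · have h1 := (hΦ ω h).map_star x
    have h2 := (hΨ ω h).map_star x
    simp only [ContinuousLinearMap.coe_coe, ContinuousLinearMap.comp_apply] at h1 h2
    simp [h1, h2]
  · have h1 := (hΦ ω h).nonneg x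
    have h2 := (hΨ ω h).nonneg x
    simp only [ContinuousLinearMap.coe_coe, ContinuousLinearMap.comp_apply] at h1 h2
    simpa using add_nonneg h1 h2

theorem smul (hΦ : PreservesPositivity Φ) {c : ℝ} (hc : 0 ≤ c) :
    PreservesPositivity ((c : ℂ) • Φ) := fun ω h => by
  refine ⟨fun x => ?_, fun x => ?_⟩
  · have h1 := (hΦ ω h).map_star x
    simp only [ContinuousLinearMap.coe_coe, ContinuousLinearMap.comp_apply] at h1
    simp [h1]
  · have h1 := (hΦ ω h).nonneg x
    simp only [ContinuousLinearMap.coe_coe, ContinuousLinearMap.comp_apply] at h1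
    simpa using mul_nonneg hc h1

theorem sum {ι : Type*} (s : Finset ι) (Φ : ι → 𝓑 →L[ℂ] 𝓑)
    (h : ∀ i ∈ s, PreservesPositivity (Φ i)) : PreservesPositivity (∑ i ∈ s, Φ i) := by
  classical
  induction s using Finset.induction_on with
  | empty => exact zero
  | insert i s hi ih =>
    rw [Finset.sum_insert hi]
    exact (h i (Finset.mem_insert_self i s)).add
      (ih fun j hj => h j (Finset.mem_insert_of_mem hj))

theorem mulLeftRight (u : 𝓑) :
    PreservesPositivity (ContinuousLinearMap.mulLeftRight ℂ 𝓑 (star u) u) := fun ω h => by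
  refine ⟨fun x => ?_, fun x => ?_⟩
  · have h1 := h.map_star (star u * x * u)
    simpa [mul_assoc] using h1
  · have h1 := h.nonneg (x * u)
    simpa [mul_assoc] using h1

/-- Positivity is a family of closed conditions, so it passes to the exponential series and to
limits of generators. -/
theorem isClosed : IsClosed {Φ : 𝓑 →L[ℂ] 𝓑 | PreservesPositivity Φ} := by
  have : {Φ : 𝓑 →L[ℂ] 𝓑 | PreservesPositivity Φ} =
      ⋂ (ω : 𝓑 →L[ℂ] ℂ) (_ : IsPositiveFunctional (ω : 𝓑 →ₗ[ℂ] ℂ)) (x : 𝓑),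
        {Φ : 𝓑 →L[ℂ] 𝓑 | ω (Φ (star x)) = star (ω (Φ x))} ∩
        {Φ : 𝓑 →L[ℂ] 𝓑 | 0 ≤ (ω (Φ (star x * x))).re} := by
    ext Φ
    simp only [Set.mem_ofPred_eq, Set.mem_iInter, Set.mem_inter_iff]
    exact ⟨fun h ω hω x => ⟨(h ω hω).map_star x, (h ω hω).nonneg x⟩,
      fun h ω hω => ⟨fun x => (h ω hω x).1, fun x => (h ω hω x).2⟩⟩
  rw [this]
  have hc : ∀ (ω : 𝓑 →L[ℂ] ℂ) (x : 𝓑), Continuous fun Φ : 𝓑 →L[ℂ] 𝓑 => ω (Φ x) :=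
    fun ω x => ω.continuous.comp (ContinuousLinearMap.apply ℂ 𝓑 x).continuous
  refine isClosed_iInter fun ω => isClosed_iInter fun _ => isClosed_iInter fun x => ?_
  exact (isClosed_eq (hc ω _) (hc ω x).star).inter
    (isClosed_le continuous_const (Complex.continuous_re.comp (hc ω _)))

theorem exp [CompleteSpace 𝓑] (hΦ : PreservesPositivity Φ) :
    PreservesPositivity (NormedSpace.exp Φ) := by
  refine isClosed.mem_of_tendsto (exp_series_hasSum_exp' (𝕂 := ℂ) Φ)
    (Eventually.of_forall fun s => ?_)
  refine sum s _ fun n _ => ?_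
  have := (hΦ.pow n).smul (c := ((n.factorial : ℝ))⁻¹) (by positivity)
  simpa using this

/-- The identity commutes with everything, so the exponential is `exp (-c)` times that of `c • Φ`.
-/
theorem exp_sub_one [CompleteSpace 𝓑] (hΦ : PreservesPositivity Φ) {c : ℝ} (hc : 0 ≤ c) :
    PreservesPositivity (NormedSpace.exp ((c : ℂ) • (Φ - 1))) := by
  let _ : NormedAlgebra ℚ (𝓑 →L[ℂ] 𝓑) := NormedAlgebra.restrictScalars ℚ ℂ _
  have e : (c : ℂ) • (Φ - 1) = algebraMap ℂ (𝓑 →L[ℂ] 𝓑) (-c : ℂ) + (c : ℂ) • Φ := by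
    rw [Algebra.algebraMap_eq_smul_one, smul_sub, neg_smul]; abel
  rw [e, exp_add_of_commute (Algebra.commutes _ _), ← algebraMap_exp_comm,
    Algebra.algebraMap_eq_smul_one, smul_mul_assoc, one_mul, ← Complex.exp_eq_exp_ℂ,
    ← Complex.ofReal_neg, ← Complex.ofReal_exp]
  exact (hΦ.smul hc).exp.smul (Real.exp_pos _).le

end PreservesPositivity

/-- The Heisenberg-picture generator with the jump operators `K`. -/
noncomputable def gksl {J : Type*} [Fintype J] (K : J → 𝓑) : 𝓑 →L[ℂ] 𝓑 :=
  ∑ a, (ContinuousLinearMap.mulLeftRight ℂ 𝓑 (star (K a)) (K a)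
    - (1 / 2 : ℂ) • (ContinuousLinearMap.mul ℂ 𝓑 (star (K a) * K a)
      + (ContinuousLinearMap.mul ℂ 𝓑).flip (star (K a) * K a)))

theorem gksl_apply {J : Type*} [Fintype J] (K : J → 𝓑) (x : 𝓑) :
    gksl K x = ∑ a, (star (K a) * x * K a
      - (1 / 2 : ℂ) • (star (K a) * K a * x + x * (star (K a) * K a))) := by
  simp [gksl]

/-- The dynamics generated by a Lindbladian preserves positivity. -/
theorem preservesPositivity_exp_gksl [CompleteSpace 𝓑] [StarModule ℂ 𝓑] {J : Type*} [Fintype J]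
    (K : J → 𝓑) {t : ℝ} (ht : 0 ≤ t) :
    PreservesPositivity (NormedSpace.exp ((t : ℂ) • gksl K)) := by
  let _ : NormedAlgebra ℚ (𝓑 →L[ℂ] 𝓑) := NormedAlgebra.restrictScalars ℚ ℂ _
  set P := ∑ a, star (K a) * K a with hP
  have hPs : star P = P := by simp [hP, star_sum]
  set R := ContinuousLinearMap.mulLeftRight ℂ 𝓑 P P with hR
  have hstep : ∀ δ : ℝ, 0 ≤ δ →
      PreservesPositivity (1 + (δ : ℂ) • gksl K + ((δ ^ 2 / 4 : ℝ) : ℂ) • R) := by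
    intro δ hδ
    -- `x ↦ u x u` reproduces the anticommutator part of the generator to first order in `δ`; its
    -- second-order term `δ ^ 2 / 4 • P x P` is the correction `R`. The Euler step, so corrected, is
    -- of Kraus form.
    set u : 𝓑 := 1 - ((δ / 2 : ℝ) : ℂ) • P with hu
    have hus : star u = u := by simp [hu, hPs]
    have e : 1 + (δ : ℂ) • gksl K + ((δ ^ 2 / 4 : ℝ) : ℂ) • R
        = ContinuousLinearMap.mulLeftRight ℂ 𝓑 (star u) u
          + (δ : ℂ) • ∑ a, ContinuousLinearMap.mulLeftRight ℂ 𝓑 (star (K a)) (K a) := by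
      ext x
      have e1 : gksl K x = ∑ a, star (K a) * x * K a - (1 / 2 : ℂ) • (P * x + x * P) := by
        rw [gksl_apply, Finset.sum_sub_distrib, ← Finset.smul_sum, Finset.sum_add_distrib, hP,
          Finset.sum_mul, Finset.mul_sum]
      simp only [hus, add_apply, smul_apply, sum_apply, one_apply_eq_self,
        ContinuousLinearMap.mulLeftRight_apply, hR, e1]
      have e2 : u * x * u = x - ((δ / 2 : ℝ) : ℂ) • (P * x + x * P)
          + (((δ / 2 : ℝ) : ℂ) * ((δ / 2 : ℝ) : ℂ)) • (P * x * P) := by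
        simp only [hu, sub_mul, mul_sub, one_mul, mul_one, smul_mul_assoc, mul_smul_comm,
          smul_add, smul_sub, mul_smul]
        abel
      rw [e2, smul_sub, smul_smul]
      push_cast
      have : ((δ : ℂ) / 2) * (δ / 2) = δ ^ 2 / 4 := by ring
      rw [this, mul_one_div]
      abel
    rw [e]
    exact (PreservesPositivity.mulLeftRight u).add
      ((PreservesPositivity.sum _ _ fun a _ => PreservesPositivity.mulLeftRight (K a)).smul hδ)
  have hlim : Tendsto (fun n : ℕ => (t : ℂ) • (gksl K + ((1 / ((n : ℝ) + 1) / 4 : ℝ) : ℂ) • R))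
      atTop (𝓝 ((t : ℂ) • gksl K)) := by
    have h1 : Tendsto (fun n : ℕ => ((1 / ((n : ℝ) + 1) / 4 : ℝ) : ℂ)) atTop (𝓝 ((0 / 4 : ℝ) : ℂ)) :=
      (Complex.continuous_ofReal.tendsto _).comp
        (tendsto_one_div_add_atTop_nhds_zero_nat.div_const 4)
    have h2 := (tendsto_const_nhds (x := gksl K)).add (h1.smul_const R)
    have h3 := h2.const_smul (t : ℂ)
    simpa using h3
  refine PreservesPositivity.isClosed.mem_of_tendsto hlim.exp (Eventually.of_forall fun n => ?_)
  -- With `c = t / δ`, exponentiating the step minus the identity gives the dynamics of `gksl K + (δ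
  -- / 4) • R`, which tends to the wanted one as `δ → 0`.
  set δ : ℝ := 1 / ((n : ℝ) + 1) with hδ
  have hδ0 : 0 < δ := by positivity
  have := (hstep δ hδ0.le).exp_sub_one (c := t / δ) (by positivity)
  have e : ((t / δ : ℝ) : ℂ) • (1 + (δ : ℂ) • gksl K + ((δ ^ 2 / 4 : ℝ) : ℂ) • R - 1)
      = (t : ℂ) • (gksl K + ((δ / 4 : ℝ) : ℂ) • R) := by
    have hδc : (δ : ℂ) ≠ 0 := by exact_mod_cast hδ0.ne'
    rw [add_assoc, add_sub_cancel_left, smul_add, smul_add, smul_smul, smul_smul, smul_smul]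
    congr 2
    · push_cast; field_simp
    · push_cast; field_simp
  rw [e] at this
  exact this

end Semigroup

end RandomLindblad

/-! ### Growth of the weight of excited modes -/

namespace RandomLindblad

attribute [local instance] LieRing.ofAssociativeRing

theorem gronwallBound_zero_mul (K C t : ℝ) :
    gronwallBound 0 K (K * C) t = C * (Real.exp (K * t) - 1) := by
  by_cases h : K = 0
  · simp [h, gronwallBound_K0]
  · rw [gronwallBound_of_K_ne_0 h]
    field_simp
    ring

/-- The bound on the normalized weight of `m` modes. -/
noncomputable def momentBound : ℕ → ℝ
  | 0 => 1
  | m + 1 => Real.exp (12 * (m + 1) ^ 2) * momentBound m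

theorem one_le_momentBound (m : ℕ) : 1 ≤ momentBound m := by
  induction m with
  | zero => exact le_rfl
  | succ m ih => exact one_le_mul_of_one_le_of_one_le (Real.one_le_exp (by positivity)) ih

theorem momentBound_le_succ (m : ℕ) : momentBound m ≤ momentBound (m + 1) :=
  le_mul_of_one_le_left (zero_le_one.trans (one_le_momentBound m))
    (Real.one_le_exp (by positivity))

theorem momentBound_mono : Monotone momentBound := monotone_nat_of_le_succ momentBound_le_succ

section Evolution

variable {𝓑 : Type*} [NormedRing 𝓑] [NormedAlgebra ℂ 𝓑]

/-- The state at time `t` of the evolution generated by `L`, as a functional. -/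
noncomputable def evolvedState (ω : 𝓑 →L[ℂ] ℂ) (L : 𝓑 →L[ℂ] 𝓑) (t : ℝ) : 𝓑 →L[ℂ] ℂ :=
  ω.comp (NormedSpace.exp ((t : ℂ) • L))

theorem evolvedState_apply (ω : 𝓑 →L[ℂ] ℂ) (L : 𝓑 →L[ℂ] 𝓑) (t : ℝ) (x : 𝓑) :
    evolvedState ω L t x = ω (NormedSpace.exp ((t : ℂ) • L) x) := rfl

variable [CompleteSpace 𝓑]

theorem evolvedState_zero (ω : 𝓑 →L[ℂ] ℂ) (L : 𝓑 →L[ℂ] 𝓑) : evolvedState ω L 0 = ω := by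
  ext x
  rw [evolvedState_apply, exp_apply_of_apply_eq_zero (by simp)]

theorem evolvedState_of_apply_eq_zero (ω : 𝓑 →L[ℂ] ℂ) {L : 𝓑 →L[ℂ] 𝓑} (t : ℝ) {x : 𝓑}
    (h : L x = 0) : evolvedState ω L t x = ω x := by
  rw [evolvedState_apply, exp_apply_of_apply_eq_zero (by simp [h])]

variable [StarRing 𝓑] {Γ : Type*} [DecidableEq Γ] [Fintype Γ] {J : Type*} [Fintype J]
  {X : Γ → 𝓑} {w : Γ → ℝ} {p : Finset Γ → 𝓑}

/-- A generator whose jumps `a` act on the mode projections `p B` by double commutators with the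
sums `∑ γ, c a γ • X γ`, together with an initial state without excited modes. -/
structure DissipativeEvolution (X : Γ → 𝓑) (w : Γ → ℝ) (p : Finset Γ → 𝓑) (c : J → Γ → ℝ) (l : ℝ)
    (ω : 𝓑 →L[ℂ] ℂ) (L : 𝓑 →L[ℂ] 𝓑) : Prop where
  modeSystem : ModeSystem X w p
  term_eq_zero : ∀ γ, w γ = 0 → X γ = 0
  coeff_nonneg : ∀ a γ, 0 ≤ c a γ
  coeff_le_one : ∀ a γ, c a γ ≤ 1
  sum_coeff_mul_sq_le : ∀ a, ∑ γ, c a γ * w γ ^ 2 ≤ 1 / 8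
  sum_coeff_le : ∀ γ, ∑ a, c a γ ≤ l
  rate_nonneg : 0 ≤ l
  initial_one : ω 1 = 1
  initial_proj : ∀ B : Finset Γ, B.Nonempty → ω (p B) = 0
  generator_proj : ∀ B, L (p B) =
    ∑ a, (-2 : ℂ) • ⁅∑ γ, (c a γ : ℂ) • X γ, ⁅∑ γ, (c a γ : ℂ) • X γ, p B⁆⁆
  positive : ∀ t : ℝ, 0 ≤ t → IsPositiveFunctional (evolvedState ω L t : 𝓑 →ₗ[ℂ] ℂ)

namespace DissipativeEvolution

variable {c : J → Γ → ℝ} {l : ℝ} {ω : 𝓑 →L[ℂ] ℂ} {L : 𝓑 →L[ℂ] 𝓑}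
  (D : DissipativeEvolution X w p c l ω L)
include D

/-- A mode of strength zero has `X β = 0`, so `L` annihilates `p {β}` and its weight stays at the
initial value `0`; `p B` lies below `p {β}`. This covers the case in which the weight cannot be
normalized by the product of the strengths. -/
theorem evolvedState_proj_eq_zero {B : Finset Γ} {β : Γ} (hβ : β ∈ B) (hw : w β = 0) {t : ℝ}
    (ht : 0 ≤ t) : (evolvedState ω L t (p B)).re = 0 := by
  have S := D.modeSystem
  have h1 : L (p {β}) = 0 := by
    rw [D.generator_proj]
    refine Finset.sum_eq_zero fun a _ => ?_
    have : ⁅∑ γ, (c a γ : ℂ) • X γ, p {β}⁆ = 0 := by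
      rw [sum_lie]
      refine Finset.sum_eq_zero fun γ _ => ?_
      rw [smul_lie]
      by_cases e : γ = β
      · rw [e, D.term_eq_zero β hw, zero_lie, smul_zero]
      · rw [Ring.lie_def, S.term_proj_notMem _ _ (by simpa using e), sub_self, smul_zero]
    rw [this, lie_zero, smul_zero]
  have h2 : evolvedState ω L t (p {β}) = 0 := by
    rw [evolvedState_of_apply_eq_zero ω t h1, D.initial_proj _ (Finset.singleton_nonempty β)]
  have hω := D.positive t ht
  have h3 := S.sq_twoNorm_proj hω {β}
  have h4 := S.sq_twoNorm_proj hω B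
  have h5 := S.twoNorm_proj_anti hω (Finset.singleton_subset_iff.2 hβ)
  simp only [ContinuousLinearMap.coe_coe] at h3 h4
  rw [h2, Complex.zero_re, sq_eq_zero_iff] at h3
  rw [h3] at h5
  rw [← h4, le_antisymm h5 (twoNorm_nonneg _)]
  simp

variable [StarModule ℂ 𝓑]

/-- Induction on the size: smaller sets act as a bounded source, and Gronwall controls all sets of
the current size simultaneously, starting from weight zero. -/
theorem evolvedState_proj_le {T : ℝ} (hlT : l * T ≤ 1) (m : ℕ) : ∀ B : Finset Γ, B.card ≤ m →
    ∀ t ∈ Set.Icc 0 T, (evolvedState ω L t (p B)).re ≤ momentBound m * (∏ α ∈ B, w α) ^ 2 := by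
  have S := D.modeSystem
  induction m with
  | zero =>
    intro B hB t _
    obtain rfl : B = ∅ := Finset.card_eq_zero.1 (Nat.le_zero.1 hB)
    have h1 : L 1 = 0 := by
      rw [← S.proj_empty, D.generator_proj]
      refine Finset.sum_eq_zero fun a _ => ?_
      rw [S.proj_empty, Ring.lie_def (∑ γ, (c a γ : ℂ) • X γ) 1]
      simp
    rw [S.proj_empty, evolvedState_of_apply_eq_zero ω t h1, D.initial_one]
    simp [momentBound]
  | succ m ih =>
    intro B hB t ht
    rcases hB.lt_or_eq with hB | hB
    · exact (ih B (Nat.lt_succ_iff.1 hB) t ht).trans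
        (mul_le_mul_of_nonneg_right (momentBound_le_succ m) (sq_nonneg _))
    set Q := momentBound m with hQ
    have hQ0 : 0 ≤ Q := zero_le_one.trans (one_le_momentBound m)
    set I := {B : Finset Γ // B.card = m + 1}
    set W : Finset Γ → ℝ := fun B => (∏ α ∈ B, w α) ^ 2 with hW
    have hw0 : ∀ B' : Finset Γ, 0 ≤ ∏ α ∈ B', w α := fun B' =>
      Finset.prod_nonneg fun α _ => S.strength_nonneg α
    have hW0 : ∀ B, 0 ≤ W B := fun B => sq_nonneg _
    -- The normalized weights of all sets of size `m + 1` form one vector in the sup norm, since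
    -- replacing a mode of `B` by another one couples sets of equal size.
    set f : ℝ → I → ℝ := fun s B => (evolvedState ω L s (p B.1)).re / W B.1 with hf
    set f' : ℝ → I → ℝ := fun s B => (evolvedState ω L s (L (p B.1))).re / W B.1 with hf'
    have hd : ∀ s, HasDerivAt f (f' s) s := fun s => hasDerivAt_pi.2 fun B =>
      (hasDerivAt_apply_exp ω L (p B.1) s).div_const _
    have hfW : ∀ s, 0 ≤ s → ∀ B : I,
        (evolvedState ω L s (p B.1)).re ≤ ‖f s‖ * W B.1 := by
      intro s hs B
      by_cases h0 : W B.1 = 0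
      · rw [h0, mul_zero]
        obtain ⟨β, hβ, hβ0⟩ := Finset.prod_eq_zero_iff.1 (pow_eq_zero_iff two_ne_zero |>.1 h0)
        exact (D.evolvedState_proj_eq_zero hβ hβ0 hs).le
      · have h1 : f s B * W B.1 = (evolvedState ω L s (p B.1)).re := div_mul_cancel₀ _ h0
        rw [← h1]
        exact mul_le_mul_of_nonneg_right ((le_abs_self _).trans (norm_le_pi_norm (f s) B)) (hW0 _)
    have hsqrt : ∀ s, 0 ≤ s → ∀ (B : Finset Γ) (M : ℝ), 0 ≤ M →
        (evolvedState ω L s (p B)).re ≤ M * W B →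
        twoNorm (evolvedState ω L s : 𝓑 →ₗ[ℂ] ℂ) (p B) ≤ √M * ∏ α ∈ B, w α := by
      intro s hs B M hM h
      have h1 := S.sq_twoNorm_proj (D.positive s hs) B
      simp only [ContinuousLinearMap.coe_coe] at h1
      refine (abs_le_of_sq_le_sq' ?_ (mul_nonneg (Real.sqrt_nonneg _) (hw0 _))).2
      rw [h1, mul_pow, Real.sq_sqrt hM]
      exact h
    set K := l * (12 * ((m + 1 : ℕ) : ℝ) ^ 2) with hK
    have hbound : ∀ s ∈ Set.Ico 0 T, ‖f' s‖ ≤ K * ‖f s‖ + K * Q := by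
      intro s hs
      have hK0 : 0 ≤ K := mul_nonneg D.rate_nonneg (by positivity)
      have hR0 : 0 ≤ K * ‖f s‖ + K * Q :=
        add_nonneg (mul_nonneg hK0 (norm_nonneg _)) (mul_nonneg hK0 hQ0)
      refine (pi_norm_le_iff_of_nonneg hR0).2 fun B => ?_
      -- Square roots convert weights into 2-norms; as the estimate depends on `r ^ 2 + q ^ 2`, it
      -- is affine in `‖f s‖`, the form needed for Gronwall.
      have h1 := S.norm_apply_sum_lie_lie_le (J := J) (D.positive s hs.1) (B := B.1)
        (q := √Q) (r := √‖f s‖) (c := c) (l := l)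
        (fun B' hB' => hsqrt s hs.1 B' Q hQ0
          (ih B' (by have := B.2; omega) s ⟨hs.1, hs.2.le⟩))
        (fun B' hB' => hsqrt s hs.1 B' _ (norm_nonneg _) (hfW s hs.1 ⟨B', hB'.trans B.2⟩))
        (Real.sqrt_nonneg _) (Real.sqrt_nonneg _) D.coeff_nonneg D.coeff_le_one
        D.sum_coeff_mul_sq_le D.sum_coeff_le
      rw [← D.generator_proj, Real.sq_sqrt hQ0, Real.sq_sqrt (norm_nonneg _), B.2] at h1
      rw [hf', Real.norm_eq_abs, abs_div, abs_of_nonneg (hW0 _)]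
      refine div_le_of_le_mul₀ (hW0 _) hR0 ?_
      refine (Complex.abs_re_le_norm _).trans (h1.trans_eq ?_)
      ring
    have h0 : ‖f 0‖ ≤ 0 := by
      refine (pi_norm_le_iff_of_nonneg le_rfl).2 fun B => ?_
      have : B.1.Nonempty := Finset.card_pos.1 (by rw [B.2]; omega)
      simp [hf, evolvedState_zero, D.initial_proj _ this]
    have hg := norm_le_gronwallBound_of_norm_deriv_right_le (f := f) (f' := f')
      (fun s _ => (hd s).continuousAt.continuousWithinAt) (fun s _ => (hd s).hasDerivWithinAt)
      h0 hbound t ht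
    rw [gronwallBound_zero_mul, sub_zero] at hg
    refine (hfW t ht.1 ⟨B, hB⟩).trans (mul_le_mul_of_nonneg_right (hg.trans ?_) (hW0 _))
    have h2 : K * t ≤ 12 * ((m : ℝ) + 1) ^ 2 := by
      have h3 : l * t ≤ 1 := (mul_le_mul_of_nonneg_left ht.2 D.rate_nonneg).trans hlT
      have h4 := mul_le_mul_of_nonneg_right h3 (by positivity : 0 ≤ 12 * ((m : ℝ) + 1) ^ 2)
      rw [hK]; push_cast; linarith
    have h3 := Real.exp_le_exp.2 h2
    rw [momentBound]
    nlinarith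

/-- A contraction times a product of signs has an expectation of the order of the product of the
strengths. -/
theorem norm_evolvedState_mul_le {T : ℝ} (hlT : l * T ≤ 1) {t : ℝ} (ht : t ∈ Set.Icc 0 T)
    (U : Finset Γ) {O r z : 𝓑} {κ : ℝ} (hκ : 0 ≤ κ)
    (hO : star O * O + star r * r = ((κ ^ 2 : ℝ) : ℂ) • 1) (hOp : ∀ B, O * p B = p B * O)
    (hz : star z * z = 1) (hzp : z = ∑ B ∈ U.powerset, p B * z * p (U \ B)) :
    ‖evolvedState ω L t (O * z)‖ ≤
      2 ^ U.card * momentBound U.card * κ * ∏ α ∈ U, w α := by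
  have S := D.modeSystem
  have hω := D.positive t ht.1
  have hw0 : ∀ B' : Finset Γ, 0 ≤ ∏ α ∈ B', w α := fun B' =>
    Finset.prod_nonneg fun α _ => S.strength_nonneg α
  set M := momentBound U.card with hM
  have hM0 : 0 ≤ M := zero_le_one.trans (one_le_momentBound _)
  have hsqrt : ∀ B, B ⊆ U →
      twoNorm (evolvedState ω L t : 𝓑 →ₗ[ℂ] ℂ) (p B) ≤ √M * ∏ α ∈ B, w α := by
    intro B hB
    have h1 := S.sq_twoNorm_proj hω B
    simp only [ContinuousLinearMap.coe_coe] at h1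
    refine (abs_le_of_sq_le_sq' ?_ (mul_nonneg (Real.sqrt_nonneg _) (hw0 _))).2
    rw [h1, mul_pow, Real.sq_sqrt hM0]
    exact D.evolvedState_proj_le hlT U.card B (Finset.card_le_card hB) t ht
  -- Because `O` commutes with `p B`, the left projection can be moved past it, ready for
  -- Cauchy-Schwarz.
  have e : O * z = ∑ B ∈ U.powerset, star (p B) * (O * (z * p (U \ B))) := by
    conv_lhs => rw [hzp, Finset.mul_sum]
    refine Finset.sum_congr rfl fun B _ => ?_
    rw [S.star_proj, ← mul_assoc, ← mul_assoc, ← mul_assoc, hOp]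
    noncomm_ring
  rw [e, map_sum]
  refine (norm_sum_le _ _).trans ?_
  have h1 : ∀ B ∈ U.powerset, ‖evolvedState ω L t (star (p B) * (O * (z * p (U \ B))))‖
      ≤ M * κ * ∏ α ∈ U, w α := by
    intro B hB
    have hBU := Finset.mem_powerset.1 hB
    have h2 := hω.norm_apply_star_mul_le (p B) (O * (z * p (U \ B)))
    have h3 := hω.twoNorm_mul_le hκ hO (z * p (U \ B))
    rw [twoNorm_mul_eq (u := z) zero_le_one (by simpa using hz), one_mul] at h3
    refine h2.trans ?_
    calc _ ≤ (√M * ∏ α ∈ B, w α) * (κ * (√M * ∏ α ∈ U \ B, w α)) := by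
          refine mul_le_mul (hsqrt B hBU) (h3.trans ?_) (twoNorm_nonneg _)
            (mul_nonneg (Real.sqrt_nonneg _) (hw0 _))
          exact mul_le_mul_of_nonneg_left (hsqrt _ Finset.sdiff_subset) hκ
      _ = (√M) ^ 2 * κ * ((∏ α ∈ U \ B, w α) * ∏ α ∈ B, w α) := by ring
      _ = _ := by rw [Real.sq_sqrt hM0, Finset.prod_sdiff hBU]
  refine (Finset.sum_le_card_nsmul _ _ _ h1).trans_eq ?_
  rw [Finset.card_powerset, nsmul_eq_mul]
  push_cast
  ring

end DissipativeEvolution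

end Evolution

end RandomLindblad

/-! ### Multiplication by signs as matrices -/

namespace RandomLindblad

open Matrix
open scoped symmDiff

section SignMatrices

variable {Γ : Type*}

theorem sign_mul_self (u : ℤˣ) : ((u : ℤ) : ℂ) * ((u : ℤ) : ℂ) = 1 := by
  rcases Int.units_eq_one_or u with rfl | rfl <;> simp

/-- The value of the monomial `∏ α ∈ S, s α`. -/
def signMonomial (s : Γ → ℤˣ) (S : Finset Γ) : ℂ := ∏ α ∈ S, ((s α : ℤ) : ℂ)

theorem star_signMonomial (s : Γ → ℤˣ) (S : Finset Γ) :
    star (signMonomial s S) = signMonomial s S := by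
  simp [signMonomial]

variable [DecidableEq Γ]

/-- In the basis of the monomials in the signs, indexed by finite sets, the multiplication by the
monomial `∏ α ∈ U, s α`. -/
def shiftMatrix (U : Finset Γ) : Matrix (Finset Γ) (Finset Γ) ℂ :=
  of fun S S' => if S = S' ∆ U then 1 else 0

/-- In the basis of the monomials in the signs, the projection onto the span of the multiples of
`∏ α ∈ B, s α`. -/
def modeMatrix (B : Finset Γ) : Matrix (Finset Γ) (Finset Γ) ℂ :=
  diagonal fun S => if B ⊆ S then 1 else 0

theorem conjTranspose_shiftMatrix (U : Finset Γ) : (shiftMatrix U)ᴴ = shiftMatrix U := by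
  ext S S'
  have : S' = S ∆ U ↔ S = S' ∆ U := by
    constructor <;> rintro rfl <;> simp
  simp [shiftMatrix, conjTranspose_apply, this, apply_ite star]

theorem conjTranspose_modeMatrix (B : Finset Γ) : (modeMatrix B)ᴴ = modeMatrix B := by
  rw [modeMatrix, diagonal_conjTranspose]
  congr 1
  ext S
  simp [apply_ite star]

theorem modeMatrix_empty : modeMatrix (∅ : Finset Γ) = 1 := by
  simp [modeMatrix]

variable [Fintype Γ]

theorem shiftMatrix_mul (U U' : Finset Γ) :
    shiftMatrix U * shiftMatrix U' = shiftMatrix (U ∆ U') := by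
  ext S S'
  simp only [shiftMatrix, mul_apply, of_apply, mul_ite, mul_one, mul_zero, Finset.sum_ite_eq',
    Finset.mem_univ, if_true, symmDiff_assoc, symmDiff_comm U]

theorem shiftMatrix_mul_self (U : Finset Γ) : shiftMatrix U * shiftMatrix U = 1 := by
  rw [shiftMatrix_mul, symmDiff_self]
  ext S S'
  have h : S' ∆ (∅ : Finset Γ) = S' := symmDiff_bot S'
  simp [shiftMatrix, one_apply, h]

theorem shiftMatrix_comm (U U' : Finset Γ) :
    shiftMatrix U * shiftMatrix U' = shiftMatrix U' * shiftMatrix U := by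
  rw [shiftMatrix_mul, shiftMatrix_mul, symmDiff_comm]

theorem modeMatrix_mul (B B' : Finset Γ) : modeMatrix B * modeMatrix B' = modeMatrix (B ∪ B') := by
  rw [modeMatrix, modeMatrix, modeMatrix, diagonal_mul_diagonal]
  congr 1
  ext S
  simp only [Finset.union_subset_iff, ite_and, mul_ite, mul_one, mul_zero]
  split_ifs <;> rfl

theorem shiftMatrix_mul_modeMatrix {γ : Γ} {B : Finset Γ} (h : γ ∉ B) :
    shiftMatrix {γ} * modeMatrix B = modeMatrix B * shiftMatrix {γ} := by
  ext S S'
  simp only [modeMatrix, mul_diagonal, diagonal_mul, shiftMatrix, of_apply]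
  by_cases e : S = S' ∆ {γ}
  · have : B ⊆ S' ↔ B ⊆ S := by
      refine forall₂_congr fun x hx => ?_
      have : x ≠ γ := fun h' => h (h' ▸ hx)
      simp [e, Finset.mem_symmDiff, this]
    simp [e, this]
  · simp [e]

theorem shiftMatrix_mul_modeMatrix_mem {γ : Γ} {B : Finset Γ} (h : γ ∈ B) :
    shiftMatrix {γ} * modeMatrix B = (modeMatrix (B.erase γ) - modeMatrix B) * shiftMatrix {γ} := by
  ext S S'
  simp only [sub_mul, Matrix.sub_apply, modeMatrix, mul_diagonal, diagonal_mul, shiftMatrix, of_apply]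
  by_cases e : S = S' ∆ {γ}
  · have h1 : B.erase γ ⊆ S ↔ B.erase γ ⊆ S' := by
      refine forall₂_congr fun x hx => ?_
      have : x ≠ γ := Finset.ne_of_mem_erase hx
      simp [e, Finset.mem_symmDiff, this]
    have h2 : ∀ T : Finset Γ, B ⊆ T ↔ γ ∈ T ∧ B.erase γ ⊆ T := fun T => by
      rw [← Finset.insert_subset_iff, Finset.insert_erase h]
    have h3 : γ ∈ S ↔ γ ∉ S' := by simp [e, Finset.mem_symmDiff]
    simp only [h2 S, h2 S', h1, h3, if_pos e]
    by_cases h4 : γ ∈ S' <;> by_cases h5 : B.erase γ ⊆ S' <;> simp [h4, h5]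
  · simp [e]

/-- Each mode of `U` belongs to exactly one of `S'` and `S' ∆ U`, so for a nonzero entry exactly one
`B` contributes, namely `U \ S'`. -/
theorem shiftMatrix_eq_sum (U : Finset Γ) : shiftMatrix U =
    ∑ B ∈ U.powerset, modeMatrix B * shiftMatrix U * modeMatrix (U \ B) := by
  ext S S'
  simp only [Matrix.sum_apply, modeMatrix, mul_diagonal, diagonal_mul, shiftMatrix, of_apply]
  by_cases e : S = S' ∆ U
  · rw [Finset.sum_eq_single (U \ S')]
    · have h1 : U \ S' ⊆ S := by
        intro x hx
        simp only [Finset.mem_sdiff] at hx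
        simp [e, Finset.mem_symmDiff, hx]
      have h2 : U \ (U \ S') ⊆ S' := by
        intro x hx
        simp only [Finset.mem_sdiff] at hx
        tauto
      simp only [if_pos h1, if_pos h2, one_mul, mul_one]
    · intro B hB hne
      by_cases h1 : B ⊆ S
      · by_cases h2 : U \ B ⊆ S'
        · exfalso
          apply hne
          ext x
          have hx := @h1 x
          have hx' := @h2 x
          have hx'' : x ∈ B → x ∈ U := fun h => Finset.mem_powerset.1 hB h
          simp only [Finset.mem_sdiff, e, Finset.mem_symmDiff] at hx hx' ⊢
          tauto
        · rw [if_neg h2, mul_zero]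
      · rw [if_neg h1, zero_mul, zero_mul]
    · intro h
      exact absurd (Finset.mem_powerset.2 Finset.sdiff_subset) h
  · simp [e]

theorem signMonomial_eq_prod_ite (s : Γ → ℤˣ) (S : Finset Γ) :
    signMonomial s S = ∏ α, if α ∈ S then ((s α : ℤ) : ℂ) else 1 := by
  simp [signMonomial]

theorem signMonomial_symmDiff (s : Γ → ℤˣ) (S U : Finset Γ) :
    signMonomial s (S ∆ U) = signMonomial s S * signMonomial s U := by
  rw [signMonomial_eq_prod_ite, signMonomial_eq_prod_ite, signMonomial_eq_prod_ite,
    ← Finset.prod_mul_distrib]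
  refine Finset.prod_congr rfl fun α _ => ?_
  have := sign_mul_self (s α)
  by_cases h1 : α ∈ S <;> by_cases h2 : α ∈ U <;> simp [Finset.mem_symmDiff, h1, h2, this]

theorem sum_signMonomial (S : Finset Γ) :
    ∑ s : Γ → ℤˣ, signMonomial s S = if S = ∅ then (Fintype.card (Γ → ℤˣ) : ℂ) else 0 := by
  have h1 := Finset.prod_univ_sum (fun _ : Γ => (Finset.univ : Finset ℤˣ))
    (fun α u => if α ∈ S then ((u : ℤ) : ℂ) else 1)
  rw [Fintype.piFinset_univ] at h1
  simp only [signMonomial_eq_prod_ite]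
  rw [← h1]
  split_ifs with h
  · subst h
    simp
  · obtain ⟨γ, hγ⟩ := Finset.nonempty_iff_ne_empty.2 h
    refine Finset.prod_eq_zero (Finset.mem_univ γ) ?_
    simp [hγ]

/-- In the basis of the monomials in the signs, the evaluation at the signs `s`. -/
noncomputable def evalMatrix (s : Γ → ℤˣ) : Matrix (Finset Γ) (Finset Γ) ℂ :=
  (Fintype.card (Γ → ℤˣ) : ℂ)⁻¹ • of fun S S' => signMonomial s S * signMonomial s S'

theorem conjTranspose_evalMatrix (s : Γ → ℤˣ) : (evalMatrix s)ᴴ = evalMatrix s := by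
  ext S S'
  have h1 := star_signMonomial s S
  have h2 := star_signMonomial s S'
  simp only [RCLike.star_def] at h1 h2
  simp [evalMatrix, h1, h2, mul_comm]

/-- This entry is the probability of the sign choice `s`. -/
theorem evalMatrix_empty (s : Γ → ℤˣ) :
    evalMatrix s ∅ ∅ = (Fintype.card (Γ → ℤˣ) : ℂ)⁻¹ := by
  simp [evalMatrix, signMonomial]

/-- `evalMatrix s` is supported on the vector `S ↦ signMonomial s S`, a joint eigenvector of all the
shifts. -/
theorem shiftMatrix_mul_evalMatrix (U : Finset Γ) (s : Γ → ℤˣ) :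
    shiftMatrix U * evalMatrix s = signMonomial s U • evalMatrix s := by
  ext S S'
  have : ∀ T : Finset Γ, S = T ∆ U ↔ S ∆ U = T := fun T =>
    ⟨by rintro rfl; simp, by rintro rfl; simp⟩
  simp only [shiftMatrix, evalMatrix, mul_apply, of_apply, Matrix.smul_apply, smul_eq_mul, ite_mul,
    one_mul, zero_mul, this, Finset.sum_ite_eq, Finset.mem_univ, if_true, signMonomial_symmDiff]
  ring

theorem evalMatrix_mul_shiftMatrix (U : Finset Γ) (s : Γ → ℤˣ) :
    evalMatrix s * shiftMatrix U = signMonomial s U • evalMatrix s := by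
  have := congrArg conjTranspose (shiftMatrix_mul_evalMatrix U s)
  rwa [conjTranspose_mul, conjTranspose_smul, conjTranspose_evalMatrix, conjTranspose_shiftMatrix,
    star_signMonomial] at this

theorem sum_evalMatrix : ∑ s : Γ → ℤˣ, evalMatrix s = 1 := by
  ext S S'
  have hc : (Fintype.card (Γ → ℤˣ) : ℂ) ≠ 0 := by exact_mod_cast Fintype.card_ne_zero
  simp only [Matrix.sum_apply, evalMatrix, Matrix.smul_apply, of_apply, ← signMonomial_symmDiff, smul_eq_mul]
  rw [← Finset.mul_sum, sum_signMonomial, one_apply]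
  by_cases h : S = S'
  · simp [h]
  · have : S ∆ S' ≠ ∅ := fun h' => h (symmDiff_eq_bot.1 h')
    simp [h, this]

/-- The joint spectral decomposition of the shifts; it is what turns the vector state of `∅` into an
average over `s`. -/
theorem shiftMatrix_eq_sum_evalMatrix (U : Finset Γ) :
    shiftMatrix U = ∑ s : Γ → ℤˣ, signMonomial s U • evalMatrix s := by
  simp only [← shiftMatrix_mul_evalMatrix]
  rw [← Finset.mul_sum, sum_evalMatrix, mul_one]

end SignMatrices

section MatrixTensor

variable {R : Type*} {E : Type*} [Ring E] [Algebra ℂ E]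

/-- The tensor product of a complex matrix and an element of an algebra. -/
def matrixTensor : Matrix R R ℂ →ₗ[ℂ] E →ₗ[ℂ] Matrix R R E :=
  LinearMap.mk₂ ℂ (fun M O => of fun i j => M i j • O)
    (fun _ _ _ => by ext; simp [add_smul]) (fun _ _ _ => by ext; simp [mul_smul])
    (fun _ _ _ => by ext; simp) (fun c M O => by ext i j; simp [smul_comm c])

theorem matrixTensor_apply (M : Matrix R R ℂ) (O : E) (i j : R) :
    matrixTensor M O i j = M i j • O := rfl

theorem matrixTensor_mul [Fintype R] (M N : Matrix R R ℂ) (O P : E) :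
    matrixTensor M O * matrixTensor N P = matrixTensor (M * N) (O * P) := by
  ext i j
  simp only [mul_apply, matrixTensor_apply, smul_mul_smul_comm, Finset.sum_smul]

theorem star_matrixTensor [StarRing E] [StarModule ℂ E] (M : Matrix R R ℂ) (O : E) :
    star (matrixTensor M O) = matrixTensor Mᴴ (star O) := by
  ext i j
  simp [star_apply, matrixTensor_apply]

theorem matrixTensor_one [DecidableEq R] : matrixTensor (1 : Matrix R R ℂ) (1 : E) = 1 := by
  ext i j
  simp [matrixTensor_apply, one_apply, ite_smul]

end MatrixTensor

end RandomLindblad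

/-! ### Intertwining, the trace state, and the algebra over the signs -/

namespace RandomLindblad

open Matrix
open scoped symmDiff

attribute [local instance] LieRing.ofAssociativeRing

section Abstract

/-- A linear functional on a finite-dimensional normed algebra, as a continuous linear map. -/
noncomputable def continuousFunctional {𝓑 : Type*} [NormedRing 𝓑] [NormedAlgebra ℂ 𝓑]
    [FiniteDimensional ℂ 𝓑] (f : 𝓑 →ₗ[ℂ] ℂ) : 𝓑 →L[ℂ] ℂ :=
  LinearMap.toContinuousLinearMap f

/-- A linear map from a finite-dimensional normed space to a normed algebra, as a continuous linear
map. -/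
noncomputable def continuousLinear {E 𝓑 : Type*} [NormedAddCommGroup E] [NormedSpace ℂ E]
    [FiniteDimensional ℂ E] [NormedRing 𝓑] [NormedAlgebra ℂ 𝓑] (f : E →ₗ[ℂ] 𝓑) : E →L[ℂ] 𝓑 :=
  LinearMap.toContinuousLinearMap f

variable {𝓑 : Type*} [NormedRing 𝓑] [NormedAlgebra ℂ 𝓑]

theorem one_add_smul_sum_mul_apply {Γ E : Type*} [Fintype Γ] [Ring E] [Algebra ℂ E]
    {D : E →ₗ[ℂ] 𝓑} {X : Γ → 𝓑} {x : Γ → E} (h : ∀ γ O, X γ * D O = D (x γ * O)) (z : ℂ)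
    (c : Γ → ℂ) (O : E) :
    (1 + z • ∑ γ, c γ • X γ) * D O = D ((1 + z • ∑ γ, c γ • x γ) * O) := by
  simp only [add_mul, one_mul, map_add, smul_mul_assoc, map_smul, Finset.sum_mul, map_sum, h]

theorem apply_mul_one_add_smul_sum {Γ E : Type*} [Fintype Γ] [Ring E] [Algebra ℂ E]
    {D : E →ₗ[ℂ] 𝓑} {X : Γ → 𝓑} {x : Γ → E} (h : ∀ γ O, D O * X γ = D (O * x γ)) (z : ℂ)
    (c : Γ → ℂ) (O : E) :
    D O * (1 + z • ∑ γ, c γ • X γ) = D (O * (1 + z • ∑ γ, c γ • x γ)) := by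
  simp only [mul_add, mul_one, map_add, mul_smul_comm, map_smul, Finset.mul_sum, map_sum, h]

theorem exp_apply_of_semiconj {E : Type*} [NormedAddCommGroup E] [NormedSpace ℂ E]
    [CompleteSpace E] [CompleteSpace 𝓑]
    {Φ : 𝓑 →L[ℂ] 𝓑} {Ψ : E →L[ℂ] E} {D : E →L[ℂ] 𝓑} (h : ∀ x, Φ (D x) = D (Ψ x)) (x : E) :
    NormedSpace.exp Φ (D x) = D (NormedSpace.exp Ψ x) := by
  have hpow : ∀ n x, (Φ ^ n) (D x) = D ((Ψ ^ n) x) := by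
    intro n
    induction n with
    | zero => intro x; rfl
    | succ n ih =>
      intro x
      rw [pow_succ, pow_succ]
      change (Φ ^ n) (Φ (D x)) = D ((Ψ ^ n) (Ψ x))
      rw [h, ih]
  have h1 := (NormedSpace.exp_series_hasSum_exp' (𝕂 := ℂ) Φ).mapL
    (ContinuousLinearMap.apply ℂ 𝓑 (D x))
  have h2 := (NormedSpace.exp_series_hasSum_exp' (𝕂 := ℂ) Ψ).mapL
    (D.comp (ContinuousLinearMap.apply ℂ E x))
  refine h1.unique ?_
  convert! h2 using 2 with n
  simp [hpow]

variable [StarRing 𝓑]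

/-- The involutions `A a` cancel, leaving the self-adjoint jumps `1 + 2 Y`. For a self-adjoint jump
`K` the dissipator is `-1/2` times a double commutator with `K`, from which the identity drops out.
-/
theorem gksl_apply_of_commute {J : Type*} [Fintype J] {K A Y : J → 𝓑} {q : 𝓑}
    (hA : ∀ a, star (A a) = A a) (hA2 : ∀ a, A a * A a = 1) (hY : ∀ a, star (Y a) = Y a)
    (hq : ∀ a, A a * q = q * A a) (hK : ∀ a, K a = A a * (1 + (2 : ℂ) • Y a)) [StarModule ℂ 𝓑] :
    gksl K q = ∑ a, (-2 : ℂ) • ⁅Y a, ⁅Y a, q⁆⁆ := by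
  rw [gksl_apply]
  refine Finset.sum_congr rfl fun a _ => ?_
  have hs : star (K a) = (1 + (2 : ℂ) • Y a) * A a := by
    rw [hK, star_mul, hA, star_add, star_one, star_smul, hY]
    simp
  have h1 : star (K a) * K a = (1 + (2 : ℂ) • Y a) * (1 + (2 : ℂ) • Y a) := by
    rw [hs, hK, mul_assoc, ← mul_assoc (A a), hA2, one_mul]
  have h2 : star (K a) * q * K a = (1 + (2 : ℂ) • Y a) * q * (1 + (2 : ℂ) • Y a) := by
    rw [hs, hK, mul_assoc _ (A a) q, hq]
    simp only [mul_assoc]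
    rw [← mul_assoc (A a) (A a), hA2, one_mul]
  rw [h1, h2]
  simp only [Ring.lie_def, add_mul, mul_add, sub_mul, mul_sub, one_mul, mul_one, smul_mul_assoc,
    mul_smul_comm, smul_add, smul_sub, smul_smul, mul_assoc]
  module

end Abstract

section TraceState

variable {V : Type*} [NormedAddCommGroup V] [InnerProductSpace ℂ V]
  [FiniteDimensional ℂ V]

theorem normalizedTrace_one [Nontrivial V] : normalizedTrace V 1 = 1 := by
  rw [normalizedTrace_apply]
  have : LinearMap.trace ℂ V 1 ≠ 0 := by
    rw [LinearMap.trace_one]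
    exact_mod_cast Module.finrank_pos.ne'
  exact div_self this

variable [CompleteSpace V]

theorem normalizedTrace_star (O : V →L[ℂ] V) :
    normalizedTrace V (star O) = star (normalizedTrace V O) := by
  have h1 : LinearMap.trace ℂ V ((star O : V →L[ℂ] V) : V →ₗ[ℂ] V)
      = star (LinearMap.trace ℂ V (O : V →ₗ[ℂ] V)) := by
    rw [LinearMap.trace_eq_sum_inner _ (stdOrthonormalBasis ℂ V),
      LinearMap.trace_eq_sum_inner _ (stdOrthonormalBasis ℂ V), star_sum]
    refine Finset.sum_congr rfl fun i _ => ?_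
    simp only [ContinuousLinearMap.coe_coe]
    rw [ContinuousLinearMap.star_eq_adjoint, ContinuousLinearMap.adjoint_inner_right]
    exact (inner_conj_symm _ _).symm
  simp only [normalizedTrace, LinearMap.coe_toContinuousLinearMap', LinearMap.smul_apply,
    LinearMap.comp_apply, ContinuousLinearMap.coeLM_apply, smul_eq_mul, star_mul', h1, star_inv₀,
    star_natCast]

theorem normalizedTrace_star_mul_self_nonneg (O : V →L[ℂ] V) :
    0 ≤ (normalizedTrace V (star O * O)).re := by
  have h1 : 0 ≤ (LinearMap.trace ℂ V ((star O * O : V →L[ℂ] V) : V →ₗ[ℂ] V)).re := by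
    rw [LinearMap.trace_eq_sum_inner _ (stdOrthonormalBasis ℂ V), Complex.re_sum]
    refine Finset.sum_nonneg fun i _ => ?_
    change 0 ≤ (inner ℂ _ (star O (O _))).re
    rw [ContinuousLinearMap.star_eq_adjoint, ContinuousLinearMap.adjoint_inner_right]
    exact inner_self_nonneg (𝕜 := ℂ)
  have h2 : normalizedTrace V (star O * O) = (((Module.finrank ℂ V : ℝ)⁻¹ : ℝ) : ℂ) *
      LinearMap.trace ℂ V ((star O * O : V →L[ℂ] V) : V →ₗ[ℂ] V) := by
    simp [normalizedTrace]
  rw [h2, Complex.re_ofReal_mul]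
  exact mul_nonneg (by positivity) h1

/-- In this algebraic form the operator norm bound carries over to `signTensor 1 O`; the row-sum
norm used on `SignAlgebra` plays no part in the estimate. -/
theorem exists_star_mul_self_add_star_mul_self {V : Type*} [NormedAddCommGroup V]
    [InnerProductSpace ℂ V] [CompleteSpace V] (O : V →L[ℂ] V) :
    ∃ r : V →L[ℂ] V, star O * O + star r * r = ((‖O‖ ^ 2 : ℝ) : ℂ) • 1 := by
  have h1 := CStarAlgebra.star_mul_le_algebraMap_norm_sq (a := O)
  obtain ⟨r, hr⟩ := CStarAlgebra.nonneg_iff_eq_star_mul_self.1 (sub_nonneg.2 h1)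
  refine ⟨r, ?_⟩
  rw [← hr, add_sub_cancel, Algebra.algebraMap_eq_smul_one, Complex.coe_smul]

end TraceState

section SignAlgebra

/-- The matrices with entries in a normed algebra, with the row-sum norm. -/
def SignAlgebra (R E : Type*) := Matrix R R E

variable {R E : Type*} [Fintype R] [DecidableEq R] [NormedRing E] [NormedAlgebra ℂ E]

noncomputable instance : NormedRing (SignAlgebra R E) := Matrix.linftyOpNormedRing (n := R) (α := E)

noncomputable instance : NormedAlgebra ℂ (SignAlgebra R E) :=
  Matrix.linftyOpNormedAlgebra (n := R) (α := E)

instance [StarRing E] : StarRing (SignAlgebra R E) := inferInstanceAs (StarRing (Matrix R R E))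

instance [StarRing E] [StarModule ℂ E] : StarModule ℂ (SignAlgebra R E) :=
  inferInstanceAs (StarModule ℂ (Matrix R R E))

instance [FiniteDimensional ℂ E] : FiniteDimensional ℂ (SignAlgebra R E) :=
  inferInstanceAs (FiniteDimensional ℂ (Matrix R R E))

instance [FiniteDimensional ℂ E] : CompleteSpace (SignAlgebra R E) := FiniteDimensional.complete ℂ _

/-- The tensor product of a complex matrix and an element of a normed algebra. -/
def signTensor : Matrix R R ℂ →ₗ[ℂ] E →ₗ[ℂ] SignAlgebra R E := matrixTensor

theorem signTensor_mul (M N : Matrix R R ℂ) (O P : E) :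
    signTensor M O * signTensor N P = signTensor (M * N) (O * P) := matrixTensor_mul M N O P

theorem star_signTensor [StarRing E] [StarModule ℂ E] (M : Matrix R R ℂ) (O : E) :
    star (signTensor M O) = signTensor Mᴴ (star O) := star_matrixTensor M O

theorem signTensor_sub (M N : Matrix R R ℂ) (O : E) :
    signTensor (M - N) O = signTensor M O - signTensor N O := by
  have : matrixTensor (M - N) O = matrixTensor M O - matrixTensor N O := by
    rw [map_sub, LinearMap.sub_apply]
  exact this

theorem signTensor_one : signTensor (1 : Matrix R R ℂ) (1 : E) = 1 := matrixTensor_one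

variable {V : Type*} [NormedAddCommGroup V] [InnerProductSpace ℂ V] [CompleteSpace V]
  [FiniteDimensional ℂ V]

/-- The trace state on the operators on `V` times the vector state of the index `i`, as a linear
map. -/
noncomputable def vectorTraceLinear (V : Type*) [NormedAddCommGroup V] [InnerProductSpace ℂ V]
    [FiniteDimensional ℂ V] (i : R) : SignAlgebra R (V →L[ℂ] V) →ₗ[ℂ] ℂ where
  toFun M := normalizedTrace V ((M : Matrix R R (V →L[ℂ] V)) i i)
  map_add' M N := map_add (normalizedTrace V) (M i i) (N i i)
  map_smul' c M := map_smul (normalizedTrace V) c (M i i)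

/-- The trace state on the operators on `V` times the vector state of the index `i`. -/
noncomputable def vectorTraceState (V : Type*) [NormedAddCommGroup V] [InnerProductSpace ℂ V]
    [FiniteDimensional ℂ V] (i : R) : SignAlgebra R (V →L[ℂ] V) →L[ℂ] ℂ :=
  continuousFunctional (vectorTraceLinear V i)

theorem vectorTraceState_signTensor (i : R) (M : Matrix R R ℂ) (O : V →L[ℂ] V) :
    vectorTraceState V i (signTensor M O) = M i i * normalizedTrace V O :=
  (map_smul (normalizedTrace V) (M i i) O).trans (smul_eq_mul _ _)

theorem isPositiveFunctional_vectorTraceState (i : R) :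
    IsPositiveFunctional (vectorTraceState V i : SignAlgebra R (V →L[ℂ] V) →ₗ[ℂ] ℂ) := by
  refine ⟨fun M => normalizedTrace_star _, fun M => ?_⟩
  let M' : Matrix R R (V →L[ℂ] V) := M
  change 0 ≤ (normalizedTrace V ((star M' * M') i i)).re
  simp only [mul_apply, star_apply, map_sum, Complex.re_sum]
  exact Finset.sum_nonneg fun j _ => normalizedTrace_star_mul_self_nonneg _

end SignAlgebra

end RandomLindblad

/-! ### Lifting the random Lindbladian to functions of the signs -/

namespace RandomLindblad

open Matrix
open scoped symmDiff

section Lift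

variable {Γ : Type*} [DecidableEq Γ] [Fintype Γ] {J : Type*} {E : Type*} [NormedRing E] [NormedAlgebra ℂ E]

/-- The term `y • s γ • H γ` on the functions of the signs. -/
noncomputable def modeTerm (H : Γ → E) (y : ℝ) (γ : Γ) : SignAlgebra (Finset Γ) E :=
  signTensor (shiftMatrix {γ}) ((y : ℂ) • H γ)

/-- The projection onto the multiples of `∏ α ∈ B, s α` on the functions of the signs. -/
noncomputable def modeProj (E : Type*) [NormedRing E] [NormedAlgebra ℂ E] (B : Finset Γ) :
    SignAlgebra (Finset Γ) E :=
  signTensor (modeMatrix B) 1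

/-- The jump operator `A a * (1 + 2 ∑ γ, b a γ * y • s γ • H γ)` on the functions of the signs. -/
noncomputable def modeJump (H : Γ → E) (A : J → E) (b : J → Γ → ℝ) (y : ℝ) (a : J) :
    SignAlgebra (Finset Γ) E :=
  signTensor 1 (A a) * (1 + (2 : ℂ) • ∑ γ, (b a γ : ℂ) • modeTerm H y γ)

/-- The jump operator `A a * (1 + 2 ∑ γ, b a γ * y • s γ • H γ)` for the signs `s`. -/
def signedJump (H : Γ → E) (A : J → E) (b : J → Γ → ℝ) (y : ℝ) (s : Γ → ℤˣ) (a : J) : E :=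
  A a * (1 + (2 : ℂ) • ∑ γ, (b a γ : ℂ) • ((y : ℂ) • ((s γ : ℤ) : ℂ) • H γ))

theorem modeTerm_mul_signTensor (H : Γ → E) (y : ℝ) (γ : Γ) (s : Γ → ℤˣ) (O : E) :
    modeTerm H y γ * signTensor (evalMatrix s) O =
      signTensor (evalMatrix s) (((y : ℂ) • ((s γ : ℤ) : ℂ) • H γ) * O) := by
  rw [modeTerm, signTensor_mul, shiftMatrix_mul_evalMatrix, map_smul, LinearMap.smul_apply,
    ← map_smul, smul_comm (y : ℂ), smul_mul_assoc (((s γ : ℤ) : ℂ))]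
  simp [signMonomial]

theorem signTensor_mul_modeTerm (H : Γ → E) (y : ℝ) (γ : Γ) (s : Γ → ℤˣ) (O : E) :
    signTensor (evalMatrix s) O * modeTerm H y γ =
      signTensor (evalMatrix s) (O * ((y : ℂ) • ((s γ : ℤ) : ℂ) • H γ)) := by
  rw [modeTerm, signTensor_mul, evalMatrix_mul_shiftMatrix, map_smul, LinearMap.smul_apply,
    ← map_smul, smul_comm (y : ℂ), mul_smul_comm (((s γ : ℤ) : ℂ))]
  simp [signMonomial]

theorem modeJump_mul_signTensor (H : Γ → E) (A : J → E) (b : J → Γ → ℝ) (y : ℝ) (s : Γ → ℤˣ)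
    (a : J) (O : E) : modeJump H A b y a * signTensor (evalMatrix s) O =
      signTensor (evalMatrix s) (signedJump H A b y s a * O) := by
  have h1 := one_add_smul_sum_mul_apply (fun γ O => modeTerm_mul_signTensor H y γ s O) 2
    (fun γ => (b a γ : ℂ)) O
  rw [modeJump, mul_assoc, h1, signTensor_mul, one_mul, signedJump, mul_assoc]

theorem signTensor_mul_modeJump (H : Γ → E) (A : J → E) (b : J → Γ → ℝ) (y : ℝ) (s : Γ → ℤˣ)
    (a : J) (O : E) : signTensor (evalMatrix s) O * modeJump H A b y a =
      signTensor (evalMatrix s) (O * signedJump H A b y s a) := by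
  rw [modeJump, ← mul_assoc, signTensor_mul, mul_one, signedJump, ← mul_assoc]
  exact apply_mul_one_add_smul_sum (fun γ O => signTensor_mul_modeTerm H y γ s O) 2
    (fun γ => (b a γ : ℂ)) (O * A a)

variable [StarRing E] [StarModule ℂ E]

theorem star_modeJump_mul_signTensor (H : Γ → E) (A : J → E) (b : J → Γ → ℝ) (y : ℝ)
    (s : Γ → ℤˣ) (a : J) (O : E) : star (modeJump H A b y a) * signTensor (evalMatrix s) O =
      signTensor (evalMatrix s) (star (signedJump H A b y s a) * O) := by
  have := congrArg star (signTensor_mul_modeJump H A b y s a (star O))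
  rwa [star_mul, star_signTensor, star_signTensor, conjTranspose_evalMatrix, star_star, star_mul,
    star_star] at this

theorem signTensor_mul_star_modeJump (H : Γ → E) (A : J → E) (b : J → Γ → ℝ) (y : ℝ)
    (s : Γ → ℤˣ) (a : J) (O : E) : signTensor (evalMatrix s) O * star (modeJump H A b y a) =
      signTensor (evalMatrix s) (O * star (signedJump H A b y s a)) := by
  have := congrArg star (modeJump_mul_signTensor H A b y s a (star O))
  rwa [star_mul, star_signTensor, star_signTensor, conjTranspose_evalMatrix, star_star, star_mul,
    star_star] at this

/-- On the sector of fixed signs `s`, each lifted jump and its adjoint act as the jump for `s`, so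
the lifted generator restricts to the Lindbladian for `s`. -/
theorem gksl_modeJump_signTensor [Fintype J] (H : Γ → E) (A : J → E) (b : J → Γ → ℝ) (y : ℝ) (s : Γ → ℤˣ)
    (O : E) : gksl (modeJump H A b y) (signTensor (evalMatrix s) O) =
      signTensor (evalMatrix s) (gksl (signedJump H A b y s) O) := by
  rw [gksl_apply, gksl_apply, map_sum]
  refine Finset.sum_congr rfl fun a _ => ?_
  rw [map_sub, map_smul, map_add]
  congr 2
  · rw [star_modeJump_mul_signTensor, signTensor_mul_modeJump]
  · congr 1
    · rw [mul_assoc, modeJump_mul_signTensor, star_modeJump_mul_signTensor, mul_assoc]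
    · rw [← mul_assoc, signTensor_mul_star_modeJump, signTensor_mul_modeJump, ← mul_assoc]

theorem modeSystem_modeTerm {H : Γ → E} {h : Γ → ℝ} (hh : ∀ γ, 0 ≤ h γ)
    (hs : ∀ γ, star (H γ) = H γ) (hsq : ∀ γ, H γ * H γ = ((h γ ^ 2 : ℝ) : ℂ) • 1)
    (hc : ∀ γ γ', H γ * H γ' = H γ' * H γ ∨ H γ * H γ' = -(H γ' * H γ)) (y : ℝ) :
    ModeSystem (modeTerm H y) (fun γ => |y| * h γ) (modeProj E) where
  strength_nonneg γ := mul_nonneg (abs_nonneg y) (hh γ)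
  star_term γ := by
    rw [modeTerm, star_signTensor, conjTranspose_shiftMatrix, star_smul, hs]
    simp
  term_sq γ := by
    rw [modeTerm, signTensor_mul, shiftMatrix_mul_self, smul_mul_smul_comm, hsq, smul_smul,
      map_smul, signTensor_one, mul_pow, sq_abs]
    congr 1
    push_cast
    ring
  term_comm γ γ' := by
    rw [modeTerm, modeTerm, signTensor_mul, signTensor_mul, shiftMatrix_comm, smul_mul_smul_comm,
      smul_mul_smul_comm]
    rcases hc γ γ' with e | e
    · exact Or.inl (by rw [e])
    · exact Or.inr (by rw [e, smul_neg, map_neg])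
  proj_empty := by rw [modeProj, modeMatrix_empty, signTensor_one]
  star_proj B := by rw [modeProj, star_signTensor, conjTranspose_modeMatrix, star_one]
  proj_mul B B' := by
    rw [modeProj, modeProj, modeProj, signTensor_mul, modeMatrix_mul, mul_one]
  term_proj_notMem γ B hγ := by
    rw [modeTerm, modeProj, signTensor_mul, signTensor_mul, shiftMatrix_mul_modeMatrix hγ, mul_one,
      one_mul]
  term_proj_mem γ B hγ := by
    have : modeProj E (B.erase γ) - modeProj E B
        = signTensor (modeMatrix (B.erase γ) - modeMatrix B) 1 := by
      rw [modeProj, modeProj, signTensor_sub]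
    rw [this, modeTerm, modeProj, signTensor_mul, signTensor_mul,
      shiftMatrix_mul_modeMatrix_mem hγ, mul_one, one_mul]

end Lift

section Bound

variable {V : Type*} [NormedAddCommGroup V] [InnerProductSpace ℂ V] [CompleteSpace V]
  [FiniteDimensional ℂ V] {Γ : Type*} [DecidableEq Γ] [Fintype Γ] {J : Type*} [Fintype J]

theorem dissipativeEvolution_modeJump [Nontrivial V]
    {H : Γ → V →L[ℂ] V} {h : Γ → ℝ} {A : J → V →L[ℂ] V}
    (hH : SymmetricTerms H h) (hA : ∀ a, IsSelfAdjoint (A a)) (hA2 : ∀ a, A a * A a = 1)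
    (hc : ∀ γ γ', H γ * H γ' = H γ' * H γ ∨ H γ * H γ' = -(H γ' * H γ))
    {b : J → Γ → ℝ} (hb0 : ∀ a γ, 0 ≤ b a γ) (hb1 : ∀ a γ, b a γ ≤ 1) {l : ℝ} (hl : 0 ≤ l)
    (hbl : ∀ γ, ∑ a, b a γ ≤ l) {y : ℝ} (hbh : ∀ a, ∑ γ, b a γ * (|y| * h γ) ^ 2 ≤ 1 / 8) :
    DissipativeEvolution (modeTerm H y) (fun γ => |y| * h γ) (modeProj (V →L[ℂ] V)) b l
      (vectorTraceState V (∅ : Finset Γ)) (gksl (modeJump H A b y)) := by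
  have S : ModeSystem (modeTerm H y) (fun γ => |y| * h γ) (modeProj (V →L[ℂ] V)) :=
    modeSystem_modeTerm hH.strength_nonneg (fun γ => hH.selfAdjoint γ) hH.sq_eq hc y
  refine ⟨S, fun γ hγ => ?_, hb0, hb1, hbh, hbl, hl, ?_, fun B hB => ?_, fun B => ?_,
    fun t ht => preservesPositivity_exp_gksl _ ht _ (isPositiveFunctional_vectorTraceState _)⟩
  · rcases mul_eq_zero.1 hγ with e | e
    · rw [modeTerm, abs_eq_zero.1 e]; simp
    · have h1 : star (H γ) * H γ = 0 := by
        rw [(hH.selfAdjoint γ).star_eq, hH.sq_eq, e]; simp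
      rw [modeTerm, CStarRing.star_mul_self_eq_zero_iff _ |>.1 h1]; simp
  · rw [← signTensor_one, vectorTraceState_signTensor, normalizedTrace_one]; simp
  · rw [modeProj, vectorTraceState_signTensor]
    simp [modeMatrix, hB.ne_empty]
  · refine gksl_apply_of_commute (A := fun a => signTensor 1 (A a)) (fun a => ?_) (fun a => ?_)
      (fun a => ?_) (fun a => ?_) fun a => rfl
    · rw [star_signTensor, (hA a).star_eq, conjTranspose_one]
    · rw [signTensor_mul, hA2, one_mul, signTensor_one]
    · simp [star_sum, S.star_term]
    · rw [modeProj, signTensor_mul, signTensor_mul, one_mul, mul_one, one_mul, mul_one]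

/-- `signTensor M` as a continuous linear map. -/
noncomputable def signTensorCLM {R : Type*} [Fintype R] [DecidableEq R] (M : Matrix R R ℂ) :
    (V →L[ℂ] V) →L[ℂ] SignAlgebra R (V →L[ℂ] V) :=
  continuousLinear (signTensor M)

/-- Decompose the shift into sectors of fixed signs: each evolves separately, contributes its
monomial value, and has its probability as diagonal entry at `∅`. -/
theorem evolvedState_modeJump (H : Γ → V →L[ℂ] V) (A : J → V →L[ℂ] V) (b : J → Γ → ℝ) (y t : ℝ)
    (U : Finset Γ) (O : V →L[ℂ] V) :
    evolvedState (vectorTraceState V (∅ : Finset Γ)) (gksl (modeJump H A b y)) t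
      (signTensor 1 O * signTensor (shiftMatrix U) 1) =
    signExpectation fun s : Γ → ℤˣ => (∏ α ∈ U, ((s α : ℤ) : ℂ)) *
      normalizedTrace V (NormedSpace.exp ((t : ℂ) • gksl (signedJump H A b y s)) O) := by
  have h1 : ∀ s : Γ → ℤˣ,
      evolvedState (vectorTraceState V (∅ : Finset Γ)) (gksl (modeJump H A b y)) t
        (signTensor (evalMatrix s) O) = (Fintype.card (Γ → ℤˣ) : ℂ)⁻¹ *
        normalizedTrace V (NormedSpace.exp ((t : ℂ) • gksl (signedJump H A b y s)) O) := by
    intro s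
    have h2 := exp_apply_of_semiconj (D := signTensorCLM (V := V) (evalMatrix s))
      (Φ := (t : ℂ) • gksl (modeJump H A b y)) (Ψ := (t : ℂ) • gksl (signedJump H A b y s))
      (fun x => by
        change (t : ℂ) • gksl (modeJump H A b y) (signTensor (evalMatrix s) x)
          = signTensor (evalMatrix s) ((t : ℂ) • gksl (signedJump H A b y s) x)
        rw [gksl_modeJump_signTensor, map_smul]) O
    rw [evolvedState_apply]
    refine (congrArg _ h2).trans ?_
    exact (vectorTraceState_signTensor _ _ _).trans (by rw [evalMatrix_empty])
  rw [signTensor_mul, one_mul, mul_one, shiftMatrix_eq_sum_evalMatrix, map_sum, LinearMap.sum_apply,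
    map_sum, signExpectation, smul_eq_mul, Finset.mul_sum]
  refine Finset.sum_congr rfl fun s _ => ?_
  rw [map_smul, LinearMap.smul_apply, map_smul, h1, smul_eq_mul, signMonomial]
  ring

theorem norm_signExpectation_le [Nontrivial V]
    {H : Γ → V →L[ℂ] V} {h : Γ → ℝ} {A : J → V →L[ℂ] V}
    (hH : SymmetricTerms H h) (hA : ∀ a, IsSelfAdjoint (A a)) (hA2 : ∀ a, A a * A a = 1)
    (hc : ∀ γ γ', H γ * H γ' = H γ' * H γ ∨ H γ * H γ' = -(H γ' * H γ))
    {b : J → Γ → ℝ} (hb0 : ∀ a γ, 0 ≤ b a γ) (hb1 : ∀ a γ, b a γ ≤ 1) {l : ℝ} (hl : 0 ≤ l)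
    (hbl : ∀ γ, ∑ a, b a γ ≤ l) {y : ℝ} (hbh : ∀ a, ∑ γ, b a γ * (|y| * h γ) ^ 2 ≤ 1 / 8)
    {t : ℝ} (ht : 0 ≤ t) (hlt : l * t ≤ 1) (U : Finset Γ) (O : V →L[ℂ] V) :
    ‖signExpectation fun s : Γ → ℤˣ => (∏ α ∈ U, ((s α : ℤ) : ℂ)) *
      normalizedTrace V (NormedSpace.exp ((t : ℂ) • gksl (signedJump H A b y s)) O)‖ ≤
    2 ^ U.card * momentBound U.card * ‖O‖ * (|y| ^ U.card * ∏ α ∈ U, h α) := by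
  have D := dissipativeEvolution_modeJump hH hA hA2 hc hb0 hb1 hl hbl hbh
  obtain ⟨r, hr⟩ := exists_star_mul_self_add_star_mul_self O
  rw [← evolvedState_modeJump]
  have := D.norm_evolvedState_mul_le hlt ⟨ht, le_rfl⟩ U (O := signTensor 1 O)
    (r := signTensor 1 r) (z := signTensor (shiftMatrix U) 1) (norm_nonneg O)
    (by
      rw [star_signTensor, star_signTensor, signTensor_mul, signTensor_mul, conjTranspose_one,
        one_mul, ← map_add, hr, map_smul, signTensor_one])
    (fun B => by
      rw [modeProj, signTensor_mul, signTensor_mul, one_mul, mul_one, one_mul, mul_one])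
    (by
      rw [star_signTensor, signTensor_mul, conjTranspose_shiftMatrix, shiftMatrix_mul_self,
        star_one, one_mul, signTensor_one])
    (by
      conv_lhs => rw [shiftMatrix_eq_sum U, map_sum, LinearMap.sum_apply]
      refine Finset.sum_congr rfl fun B _ => ?_
      rw [modeProj, modeProj, signTensor_mul, signTensor_mul, one_mul, one_mul])
  rwa [Finset.prod_mul_distrib, Finset.prod_const] at this

end Bound

end RandomLindblad

/-! ### Consequences of locality -/

namespace RandomLindblad

section Locality

variable {V : Type*} [NormedAddCommGroup V] [InnerProductSpace ℂ V] {Γ J : Type*} {n : ℕ} {site : Fin n → Set (V →L[ℂ] V)}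
  {H : Γ → V →L[ℂ] V} {h : Γ → ℝ} {A : J → V →L[ℂ] V} {b : J → Γ → ℕ} {b' : Γ → Γ → ℕ}
  {k : ℕ} {aloc aac : ℝ}

theorem LocalJumps.exists_natCast_eq_aloc [Fintype J] (hL : LocalJumps site H A b k aloc aac) (i : Fin n) :
    ∃ m : ℕ, aloc = m :=
  ⟨_, by simpa using (hL.card_jumps {i}).symm⟩

theorem LocalJumps.aloc_mul_nonneg [Fintype J] (hL : LocalJumps site H A b k aloc aac) (γ : Γ) :
    0 ≤ aloc * k := by
  rcases (opSupport site (H γ)).eq_empty_or_nonempty with e | ⟨i, -⟩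
  · have := hL.term_card γ
    rw [e, Finset.card_empty] at this
    simp [← this]
  · obtain ⟨m, rfl⟩ := hL.exists_natCast_eq_aloc i
    positivity

theorem sum_sq_le_localEnergy_sq [Fintype Γ] (i : Fin n) :
    ∑ γ with i ∈ opSupport site (H γ), h γ ^ 2 ≤ localEnergy site H h ^ 2 := by
  have h0 : 0 ≤ ∑ γ with i ∈ opSupport site (H γ), h γ ^ 2 :=
    Finset.sum_nonneg fun γ _ => sq_nonneg _
  rw [← Real.sq_sqrt h0]
  exact pow_le_pow_left₀ (Real.sqrt_nonneg _)
    (le_ciSup (f := fun i : Fin n => √(∑ γ with i ∈ opSupport site (H γ), h γ ^ 2))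
      (Set.finite_range _).bddAbove i) 2

variable [CompleteSpace V]

theorem CommuteOrAnticommute.commute_or_anticommute (h : CommuteOrAnticommute site H A b b')
    (γ γ' : Γ) : H γ * H γ' = H γ' * H γ ∨ H γ * H γ' = -(H γ' * H γ) := by
  have := h.term_comm γ γ'
  rcases h.term_zero_or_one γ γ' with e | e
  · left
    rw [e] at this
    simpa [sub_eq_zero] using this
  · right
    rw [e, Nat.cast_one, one_mul, two_smul, sub_eq_iff_eq_add, add_assoc, left_eq_add] at this
    exact eq_neg_of_add_eq_zero_left this

variable [Fintype Γ]

/-- The commutator with `A a` keeps only the anticommuting terms, doubled, so `A a` factors out on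
the left. -/
theorem CommuteOrAnticommute.lindbladOp_eq_signedJump (h : CommuteOrAnticommute site H A b b')
    (y : ℝ) (s : Γ → ℤˣ) (a : J) : lindbladOp y (A a) (hamiltonian H s) =
      signedJump H A (fun a γ => (b a γ : ℝ)) y s a := by
  have h1 : A a * hamiltonian H s - hamiltonian H s * A a =
      (2 : ℂ) • ∑ γ, (b a γ : ℂ) • ((s γ : ℤ) : ℂ) • (A a * H γ) := by
    rw [hamiltonian, Finset.mul_sum, Finset.sum_mul, ← Finset.sum_sub_distrib, Finset.smul_sum]
    refine Finset.sum_congr rfl fun γ _ => ?_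
    rw [mul_smul_comm, smul_mul_assoc, ← smul_sub, h.jump_comm]
    module
  rw [lindbladOp, h1, signedJump, mul_add, mul_one, mul_smul_comm, Finset.mul_sum,
    smul_comm (y : ℂ), Finset.smul_sum]
  congr 2
  refine Finset.sum_congr rfl fun γ _ => ?_
  rw [mul_smul_comm, mul_smul_comm, mul_smul_comm, smul_comm (y : ℂ)]
  simp

theorem CommuteOrAnticommute.lindbladian_eq_gksl [Fintype J] (h : CommuteOrAnticommute site H A b b')
    (y : ℝ) (s : Γ → ℤˣ) :
    lindbladian H A y s = gksl (signedJump H A (fun a γ => (b a γ : ℝ)) y s) := by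
  ext1 O
  rw [gksl_apply, lindbladian, _root_.sum_apply]
  refine Finset.sum_congr rfl fun a _ => ?_
  rw [dissipator_apply, h.lindbladOp_eq_signedJump]

/-- The jump lives on one site `i`, and only terms whose support contains `i` can anticommute with
it, so the sum is at most `y ^ 2` times the squared local energy. The factor `aloc * k` of the
hypothesis can be discarded because it is at least `1` whenever the sum is nonzero. -/
theorem sum_mul_sq_le [Fintype J] (hC : CommuteOrAnticommute site H A b b')
    (hL : LocalJumps site H A b k aloc aac) {y : ℝ}
    (hy : y ^ 2 * localEnergy site H h ^ 2 * aloc * k < 1 / 8) (a : J) :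
    ∑ γ, (b a γ : ℝ) * (|y| * h γ) ^ 2 ≤ 1 / 8 := by
  by_cases h0 : ∀ γ, b a γ = 0
  · simp [h0]
  push Not at h0
  obtain ⟨γ₀, hγ₀⟩ := h0
  obtain ⟨i, hi⟩ := Finset.card_eq_one.1 (hL.jump_card a)
  have hmem : ∀ γ, b a γ ≠ 0 → i ∈ opSupport site (H γ) := fun γ hγ => by
    by_contra hn
    exact hγ (hC.jump_disjoint a γ (by rwa [hi, Finset.disjoint_singleton_left]))
  have hk : 1 ≤ k := by
    rw [← hL.term_card γ₀]
    exact Finset.card_pos.2 ⟨i, hmem γ₀ hγ₀⟩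
  obtain ⟨m, rfl⟩ := hL.exists_natCast_eq_aloc i
  -- The jump `a` anticommutes with `γ₀`, hence `0 < aac * k`, which is impossible if `aac ≤ aloc =
  -- 0`.
  have hm : m ≠ 0 := by
    rintro rfl
    have h1 := hL.sum_anticommuting γ₀
    have h2 : (b a γ₀ : ℝ) ≤ ∑ a, (b a γ₀ : ℝ) :=
      Finset.single_le_sum (f := fun a => (b a γ₀ : ℝ)) (fun a _ => Nat.cast_nonneg _)
        (Finset.mem_univ a)
    have h3 : aac * k ≤ 0 :=
      mul_nonpos_of_nonpos_of_nonneg (by simpa using hL.aac_le_aloc) (Nat.cast_nonneg _)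
    have h4 : (0 : ℝ) < b a γ₀ := by exact_mod_cast Nat.pos_of_ne_zero hγ₀
    linarith
  have hmk : (1 : ℝ) ≤ m * k := by
    exact_mod_cast Nat.mul_pos (Nat.pos_of_ne_zero hm) hk
  have h1 : ∑ γ, (b a γ : ℝ) * (|y| * h γ) ^ 2
      ≤ y ^ 2 * ∑ γ with i ∈ opSupport site (H γ), h γ ^ 2 := by
    rw [Finset.mul_sum, Finset.sum_filter]
    refine Finset.sum_le_sum fun γ _ => ?_
    rw [mul_pow, sq_abs]
    rcases hC.jump_zero_or_one a γ with e | e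
    · rw [e, Nat.cast_zero, zero_mul]
      split_ifs <;> positivity
    · rw [if_pos (hmem γ (by simp [e])), e, Nat.cast_one, one_mul]
  have h2 : y ^ 2 * ∑ γ with i ∈ opSupport site (H γ), h γ ^ 2
      ≤ y ^ 2 * localEnergy site H h ^ 2 :=
    mul_le_mul_of_nonneg_left (sum_sq_le_localEnergy_sq i) (sq_nonneg y)
  have h3 : y ^ 2 * localEnergy site H h ^ 2 ≤ y ^ 2 * localEnergy site H h ^ 2 * (m * k) :=
    le_mul_of_one_le_right (by positivity) hmk
  rw [← mul_assoc] at h3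
  linarith

end Locality

/-! ### The double time integral -/

section Integral

theorem norm_doubleIntegral_le {E : Type*} [NormedAddCommGroup E] [NormedSpace ℝ E] {f : ℝ → E}
    {c t : ℝ} (ht : 0 ≤ t) (h : ∀ x ∈ Set.Icc 0 t, ‖f x‖ ≤ c) :
    ‖∫ t₂ in (0 : ℝ)..t, ∫ t₁ in (0 : ℝ)..t₂, f t₁‖ ≤ c * t ^ 2 := by
  have hc : 0 ≤ c := (norm_nonneg _).trans (h 0 ⟨le_rfl, ht⟩)
  have h1 : ∀ t₂ ∈ Set.uIoc 0 t, ‖∫ t₁ in (0 : ℝ)..t₂, f t₁‖ ≤ c * t := by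
    intro t₂ ht₂
    rw [Set.uIoc_of_le ht] at ht₂
    have := intervalIntegral.norm_integral_le_of_norm_le_const (a := 0) (b := t₂) (f := f) (C := c)
      (fun x hx => by
        rw [Set.uIoc_of_le ht₂.1.le] at hx
        exact h x ⟨hx.1.le, hx.2.trans ht₂.2⟩)
    rw [sub_zero, abs_of_pos ht₂.1] at this
    exact this.trans (mul_le_mul_of_nonneg_left ht₂.2 hc)
  have := intervalIntegral.norm_integral_le_of_norm_le_const h1
  rwa [sub_zero, abs_of_nonneg ht, mul_assoc, ← sq] at this

theorem continuous_exp_smul {𝓐 : Type*} [NormedRing 𝓐] [NormedAlgebra ℂ 𝓐] [CompleteSpace 𝓐]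
    (L : 𝓐) : Continuous fun t : ℝ => NormedSpace.exp ((t : ℂ) • L) :=
  (differentiable_exp_smul_const ℂ L).continuous.comp Complex.continuous_ofReal

variable {E F : Type*} [NormedAddCommGroup E] [NormedSpace ℂ E] [CompleteSpace E]
  [NormedAddCommGroup F] [NormedSpace ℂ F]

theorem map_doubleIntegral [CompleteSpace F] {f : ℝ → E} (hf : Continuous f) (D : E →L[ℂ] F) (t : ℝ) :
    D (∫ t₂ in (0 : ℝ)..t, ∫ t₁ in (0 : ℝ)..t₂, f t₁) =
      ∫ t₂ in (0 : ℝ)..t, ∫ t₁ in (0 : ℝ)..t₂, D (f t₁) := by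
  have h1 : Continuous fun t₂ => ∫ t₁ in (0 : ℝ)..t₂, f t₁ :=
    intervalIntegral.continuous_primitive (fun a b => hf.intervalIntegrable a b) 0
  rw [← D.intervalIntegral_comp_comm (h1.intervalIntegrable 0 t)]
  refine intervalIntegral.integral_congr fun t₂ _ => ?_
  exact (D.intervalIntegral_comp_comm (hf.intervalIntegrable 0 t₂)).symm

theorem sum_doubleIntegral {ι : Type*} [Fintype ι] {f : ι → ℝ → F} (hf : ∀ i, Continuous (f i))
    (t : ℝ) : ∑ i, ∫ t₂ in (0 : ℝ)..t, ∫ t₁ in (0 : ℝ)..t₂, f i t₁ =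
      ∫ t₂ in (0 : ℝ)..t, ∫ t₁ in (0 : ℝ)..t₂, ∑ i, f i t₁ := by
  have h1 : ∀ i, Continuous fun t₂ => ∫ t₁ in (0 : ℝ)..t₂, f i t₁ := fun i =>
    intervalIntegral.continuous_primitive (fun a b => (hf i).intervalIntegrable a b) 0
  rw [← intervalIntegral.integral_finsetSum fun i _ => (h1 i).intervalIntegrable 0 t]
  refine intervalIntegral.integral_congr fun t₂ _ => ?_
  exact (intervalIntegral.integral_finsetSum fun i _ => (hf i).intervalIntegrable 0 t₂).symm

end Integral

/-- Expectation, trace and evaluation at `O` are continuous linear, so they move inside the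
integrals and a bound at each fixed time is enough. -/
theorem signedIntegral_apply {V : Type*} [NormedAddCommGroup V] [InnerProductSpace ℂ V]
    [CompleteSpace V] [FiniteDimensional ℂ V] {Γ J : Type*} [Fintype Γ] [DecidableEq Γ] [Fintype J]
    (H : Γ → V →L[ℂ] V) (A : J → V →L[ℂ] V) (y t : ℝ) (U : Finset Γ) (O : V →L[ℂ] V) :
    signedIntegral H A y t U O = ∫ t₂ in (0 : ℝ)..t, ∫ t₁ in (0 : ℝ)..t₂,
      signExpectation fun s : Γ → ℤˣ => (∏ α ∈ U, ((s α : ℤ) : ℂ)) *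
        normalizedTrace V (NormedSpace.exp ((t₁ : ℂ) • lindbladian H A y s) O) := by
  let D : (Γ → ℤˣ) → ((V →L[ℂ] V) →L[ℂ] (V →L[ℂ] V)) →L[ℂ] ℂ := fun s =>
    ((Fintype.card (Γ → ℤˣ) : ℂ)⁻¹ * ∏ α ∈ U, ((s α : ℤ) : ℂ)) •
      (normalizedTrace V).comp (ContinuousLinearMap.apply ℂ (V →L[ℂ] V) O)
  have hD : ∀ s Φ, D s Φ = (Fintype.card (Γ → ℤˣ) : ℂ)⁻¹ *
      ((∏ α ∈ U, ((s α : ℤ) : ℂ)) * normalizedTrace V (Φ O)) := fun s Φ => mul_assoc _ _ _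
  have hc : ∀ s, Continuous fun t : ℝ => NormedSpace.exp ((t : ℂ) • lindbladian H A y s) :=
    fun s => continuous_exp_smul (lindbladian H A y s)
  simp only [signExpectation, smul_eq_mul, Finset.mul_sum, ← hD]
  refine Eq.trans ?_ (sum_doubleIntegral (fun s => (D s).continuous.comp (hc s)) t)
  rw [signedIntegral, signExpectation, _root_.smul_apply,
    _root_.sum_apply, Finset.smul_sum]
  refine Finset.sum_congr rfl fun s _ => ?_
  exact Eq.trans (hD s _).symm (map_doubleIntegral (hc s) (D s) t)

end RandomLindblad

theorem mainTheorem4 :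
    ∃ C : ℝ,
      ∀ (V : Type*) [NormedAddCommGroup V] [InnerProductSpace ℂ V] [CompleteSpace V]
        [FiniteDimensional ℂ V] [Nontrivial V]
        (Γ : Type*) [Fintype Γ] [DecidableEq Γ] (J : Type*) [Fintype J]
        (n : ℕ) (site : Fin n → Set (V →L[ℂ] V))
        (H : Γ → V →L[ℂ] V) (h : Γ → ℝ) (A : J → V →L[ℂ] V)
        (b : J → Γ → ℕ) (b' : Γ → Γ → ℕ) (k : ℕ) (aloc aac : ℝ),
        RandomLindblad.SymmetricTerms H h →
        RandomLindblad.CommuteOrAnticommute site H A b b' →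
        RandomLindblad.LocalJumps site H A b k aloc aac →
        ∀ (y t : ℝ), 0 ≤ t → aloc * k * t < 1 →
          y ^ 2 * RandomLindblad.localEnergy site H h ^ 2 * aloc * k < 1 / 8 →
          ∀ U : Finset Γ, U.card ≤ 5 →
            ‖RandomLindblad.signedIntegral H A y t U‖ ≤
              C * t ^ 2 * |y| ^ U.card * ∏ α ∈ U, h α := by
  -- Both `2 ^ U.card` and the moment bound increase with `U.card`, so their values at `5` serve for
  -- every `U`.
  refine ⟨2 ^ 5 * RandomLindblad.momentBound 5, ?_⟩
  intro V _ _ _ _ _ Γ _ _ J _ n site H h A b b' k aloc aac hH hC hL y t ht hlt hy U hU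
  have hp : 0 ≤ |y| ^ U.card * ∏ α ∈ U, h α :=
    mul_nonneg (by positivity) (Finset.prod_nonneg fun α _ => hH.strength_nonneg α)
  have hm := RandomLindblad.one_le_momentBound 5
  have hb1 : ∀ a γ, (b a γ : ℝ) ≤ 1 := fun a γ => by
    rcases hC.jump_zero_or_one a γ with e | e <;> simp [e]
  obtain ⟨l, hl, hbl, hlt'⟩ : ∃ l : ℝ, 0 ≤ l ∧ (∀ γ, ∑ a, (b a γ : ℝ) ≤ l) ∧ l * t ≤ 1 := by
    -- Without any terms, `aloc * k` may be negative when there are no sites; the rate `0` then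
    -- serves.
    rcases isEmpty_or_nonempty Γ with hΓ | ⟨⟨γ⟩⟩
    · exact ⟨0, le_rfl, fun γ => hΓ.elim γ, by simp⟩
    · refine ⟨aloc * k, hL.aloc_mul_nonneg γ, fun γ => ?_, hlt.le⟩
      rw [hL.sum_anticommuting]
      exact mul_le_mul_of_nonneg_right hL.aac_le_aloc (Nat.cast_nonneg _)
  refine ContinuousLinearMap.opNorm_le_bound _ (by rw [mul_assoc]; positivity) fun O => ?_
  have hconst : 2 ^ U.card * RandomLindblad.momentBound U.card ≤
      2 ^ 5 * RandomLindblad.momentBound 5 :=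
    mul_le_mul (pow_le_pow_right₀ one_le_two hU) (RandomLindblad.momentBound_mono hU)
      (zero_le_one.trans (RandomLindblad.one_le_momentBound _)) (by positivity)
  rw [RandomLindblad.signedIntegral_apply]
  have := RandomLindblad.norm_doubleIntegral_le ht
    (f := fun t₁ => RandomLindblad.signExpectation fun s : Γ → ℤˣ => (∏ α ∈ U, ((s α : ℤ) : ℂ)) *
      RandomLindblad.normalizedTrace V
        (NormedSpace.exp ((t₁ : ℂ) • RandomLindblad.lindbladian H A y s) O))
    (c := 2 ^ 5 * RandomLindblad.momentBound 5 * (‖O‖ * (|y| ^ U.card * ∏ α ∈ U, h α)))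
    fun t₁ ht₁ => by
      simp only [hC.lindbladian_eq_gksl]
      refine (RandomLindblad.norm_signExpectation_le hH hC.jump_selfAdjoint hC.jump_sq
        hC.commute_or_anticommute (fun a γ => Nat.cast_nonneg _) hb1 hl hbl
        (RandomLindblad.sum_mul_sq_le hC hL hy) ht₁.1
        ((mul_le_mul_of_nonneg_left ht₁.2 hl).trans hlt') U O).trans ?_
      rw [mul_assoc _ ‖O‖]
      exact mul_le_mul_of_nonneg_right hconst (mul_nonneg (norm_nonneg O) hp)
  refine this.trans_eq ?_
  ring
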